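/- Notation. Let $\mathbb{H}_2$ be the Siegel upper half-space of degree $2$, and write $e(x)=e^{2\pi i x}$. For a commutative ring $R$ let $G_n^J(R)=Sp_n(R)\ltimes H_n(R)$ be the Jacobi group, $H_n(R)=\{(\lambda,\mu,\kappa):\lambda,\mu\in R^n,\ \kappa\in R\}$ the Heisenberg group; a pair $(g,h)$ stands for the product $gh$. For $\gamma=(g,h)\in G_2^J(\mathbb{R})$ with $g=\left(\begin{smallmatrix}A&B\\C&D\end{smallmatrix}\right)$, $h=(\lambda,\mu,\kappa)$, a function $\Phi$ on $\mathbb{H}_2\times\mathbb{C}^2$ and $Z_1:=Z+\lambda\mathcal{T}+\mu$, put $$(\Phi|_{k,m}\gamma)(\mathcal{T},Z)=\det(C\mathcal{T}+D)^{-k}\,e\!\left(-m\,Z_1(C\mathcal{T}+D)^{-1}CZ_1^t\right)e\!\left(m(\lambda\mathcal{T}\lambda^t+2\lambda Z^t+\kappa+\mu\lambda^t)\right)\,\Phi\!\left((A\mathcal{T}+B)(C\mathcal{T}+D)^{-1},\,Z_1(C\mathcal{T}+D)^{-1}\right).$$ Let $k,m$ be positive integers. A Jacobi form $\Phi\in J_{k,m}^2$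 of degree $2$, weight $k$ and index $m$ is a function $\Phi:\mathbb{H}_2\times\mathbb{C}^2\to\mathbb{C}$ with $\Phi|_{k,m}\gamma=\Phi$ for all $\gamma\in G_2^J(\mathbb{Z})$ and with an absolutely convergent Fourier expansion $$\Phi(\mathcal{T},Z)=\sum_{N,R}C(N,R)\,e(\operatorname{tr}(N\mathcal{T})+RZ^t),\qquad N=\begin{pmatrix}n_{11}&n_{12}/2\\ n_{12}/2&n_{22}\end{pmatrix},\quad R=(r_1,r_2),$$ where $n_{11},n_{12},n_{22},r_1,r_2\in\mathbb{Z}$ and $\left(\begin{smallmatrix}N&R^t/2\\R/2&m\end{smallmatrix}\right)$ is positive semidefinite; put $C(N,R)=0$ for the other integral indices. Put $$D_1=r_1^2-4mn_{11},\qquad D_2=r_2^2-4mn_{22},\qquad D=r_1r_2-2mn_{12}.$$ Then $C(N,R)$ depends only on $D_1,D_2,D$ and on $r_1,r_2$ modulo $2m$; write $C_{r_1,r_2}(D_1,D_2,D)=C(N,R)$, and let $C_{r_1,r_2}(D_1,D_2,D)=0$ for rational $D_1,D_2,D$ that do not arise in this way from integral $(N,R)$ with the given classes $r_1,r_2$ modulo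 $2m$. Let $p$ be a prime with $(p,2m)=1$, let $p\bar p\equiv1\pmod{2m}$, and let $\chi_{a}(p)=\left(\frac{a}{p}\right)$ be the Legendre symbol. The space $\mathbb{E}_{k,m}^{(p)}$ consists of those $\Phi\in J_{k,m}^2$ that satisfy the Hecke duality relation: for all $D_1,D_2,D\in\mathbb{Z}$ and all $r_1,r_2$ modulo $2m$, $$\begin{aligned}(\chi_{D_1}(p)-\chi_{D_2}(p))\,C_{r_1,r_2}(D_1,D_2,D)={}&p^{2-k}\left(C_{r_1,pr_2}(D_1,p^2D_2,pD)-C_{pr_1,r_2}(p^2D_1,D_2,pD)\right)\\&+p^{k-1}\left(C_{r_1,\bar pr_2}\!\left(D_1,\tfrac{D_2}{p^2},\tfrac Dp\right)-C_{\bar pr_1,r_2}\!\left(\tfrac{D_1}{p^2},D_2,\tfrac Dp\right)\right).\end{aligned}$$ For $g=\left(\begin{smallmatrix}a&b\\c&d\end{smallmatrix}\right)\in SL_2(\mathbb{Q})$ and $\lambda,\mu\in\mathbb{Q}$ let $(g,(\lambda,\mu))^{\uparrow}$ and $(g,(\lambda,\mu))^{\downarrow}$ be the elements of $G_2^J(\mathbb{Q})$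 with symplectic parts $$\left(\begin{smallmatrix}a&0&b&0\\0&1&0&0\\c&0&d&0\\0&0&0&1\end{smallmatrix}\right)\quad\text{and}\quad\left(\begin{smallmatrix}1&0&0&0\\0&a&0&b\\0&0&1&0\\0&c&0&d\end{smallmatrix}\right)$$ and Heisenberg parts $((\lambda,0),(\mu,0),0)$ and $((0,\lambda),(0,\mu),0)$, respectively. The two embeddings of the classical Hecke-Jacobi operator $T^J(\ell)$, $\ell\geq1$, are, for $\ast\in\{\uparrow,\downarrow\}$, $$\Phi|T^J(\ell)^{\ast}=\ell^{k-4}\sum_{M}\ \sum_{(\lambda,\mu)\in\mathbb{Z}^2/\ell\mathbb{Z}^2}\Phi|_{k,m}\left(\tfrac1\ell M,(\lambda,\mu)\right)^{\ast},$$ where $M$ runs through representatives of the finite set $SL_2(\mathbb{Z})\backslash\{M\in\operatorname{Mat}_2(\mathbb{Z}):\det M=\ell^2,\ \gcd(M)\text{ is a perfect square}\}$, $\gcd(M)$ being the greatest common divisor of the entries of $M$. Theorem. Let $k,m$ be positive integers, let $\Phi\in J_{k,m}^2$ and let $p$ be a prime with $(p,2m)=1$. Then the following two conditions are equivalent: 1.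 $\Phi\in\mathbb{E}_{k,m}^{(p)}$, that is, the Fourier coefficients of $\Phi$ satisfy the Hecke duality relation at $p$; 2. $\Phi|\left(T^J(p)^{\uparrow}-T^J(p)^{\downarrow}\right)=0$ on $\mathbb{H}_2\times\mathbb{C}^2$. -/

import Mathlib

noncomputable section

namespace HeckeJacobi

/-- The Siegel upper half-space `ℍ_n`: symmetric complex matrices with positive definite
imaginary part. -/
def siegelUpperHalfSpace (n : ℕ) : Set (Matrix (Fin n) (Fin n) ℂ) :=
  {T | T.transpose = T ∧ (T.map Complex.im).PosDef}

/-- The Jacobi group `G_n^J(R) = Sp_n(R) ⋉ H_n(R)`. An element is a pair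
`(g, h)` with `h = (lam, mu, kap)` in the Heisenberg group; it stands for the product `g * h`,
so that it acts first through `h` and then through `g`. -/
structure JacobiGroup (n : ℕ) (R : Type) [CommRing R] where
  sp : Matrix.symplecticGroup (Fin n) R
  lam : Fin n → R
  mu : Fin n → R
  kap : R

/-- `e(x) = exp(2 π i x)`. -/
def e (x : ℂ) : ℂ := Complex.exp (2 * Real.pi * Complex.I * x)

namespace JacobiGroup

variable {n : ℕ} {R : Type} [CommRing R] [Algebra R ℂ]

/-- The four `n × n` blocks of the symplectic part, as complex matrices. -/
def A (γ : JacobiGroup n R) : Matrix (Fin n) (Fin n) ℂ :=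
  γ.sp.1.toBlocks₁₁.map (algebraMap R ℂ)

def B (γ : JacobiGroup n R) : Matrix (Fin n) (Fin n) ℂ :=
  γ.sp.1.toBlocks₁₂.map (algebraMap R ℂ)

def C (γ : JacobiGroup n R) : Matrix (Fin n) (Fin n) ℂ :=
  γ.sp.1.toBlocks₂₁.map (algebraMap R ℂ)

def D (γ : JacobiGroup n R) : Matrix (Fin n) (Fin n) ℂ :=
  γ.sp.1.toBlocks₂₂.map (algebraMap R ℂ)

/-- The Heisenberg part as complex vectors and a complex number. -/
def lamC (γ : JacobiGroup n R) : Fin n → ℂ := fun i => algebraMap R ℂ (γ.lam i)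

def muC (γ : JacobiGroup n R) : Fin n → ℂ := fun i => algebraMap R ℂ (γ.mu i)

def kapC (γ : JacobiGroup n R) : ℂ := algebraMap R ℂ γ.kap

/-- `J(g, T) = C T + D`. -/
def denom (γ : JacobiGroup n R) (T : Matrix (Fin n) (Fin n) ℂ) : Matrix (Fin n) (Fin n) ℂ :=
  γ.C * T + γ.D

/-- `g ∘ T = (A T + B) (C T + D)⁻¹`. -/
def actT (γ : JacobiGroup n R) (T : Matrix (Fin n) (Fin n) ℂ) : Matrix (Fin n) (Fin n) ℂ :=
  (γ.A * T + γ.B) * (γ.denom T)⁻¹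

/-- The second component `Z + λ T + μ` of `h ∘ (T, Z)`. -/
def heisZ (γ : JacobiGroup n R) (T : Matrix (Fin n) (Fin n) ℂ) (Z : Fin n → ℂ) : Fin n → ℂ :=
  Z + Matrix.vecMul γ.lamC T + γ.muC

/-- The second component `(Z + λ T + μ) (C T + D)⁻¹` of `γ ∘ (T, Z)`. -/
def actZ (γ : JacobiGroup n R) (T : Matrix (Fin n) (Fin n) ℂ) (Z : Fin n → ℂ) : Fin n → ℂ :=
  Matrix.vecMul (γ.heisZ T Z) (γ.denom T)⁻¹

/-- The cocycle `J_{k,m}(γ, (T, Z)) = J_{k,m}(g, h ∘ (T, Z)) * J_{k,m}(h, (T, Z))` with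
`J_{k,m}(g, (T, Z)) = det (C T + D) ^ k * e(m Z (C T + D)⁻¹ C Zᵗ)` and
`J_{k,m}(h, (T, Z)) = e(-m (λ T λᵗ + 2 λ Zᵗ + κ + μ λᵗ))`. -/
def cocycle (k m : ℕ) (γ : JacobiGroup n R) (T : Matrix (Fin n) (Fin n) ℂ) (Z : Fin n → ℂ) : ℂ :=
  ((γ.denom T).det ^ k *
      e (m * (γ.heisZ T Z ⬝ᵥ Matrix.mulVec ((γ.denom T)⁻¹ * γ.C) (γ.heisZ T Z)))) *
    e (-(m * (γ.lamC ⬝ᵥ Matrix.mulVec T γ.lamC + 2 * (γ.lamC ⬝ᵥ Z) + γ.kapC + γ.muC ⬝ᵥ γ.lamC)))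

/-- The slash operator `(Φ |_{k,m} γ)(T, Z) = J_{k,m}(γ, (T, Z))⁻¹ Φ(γ ∘ (T, Z))`. Functions on
`ℍ_n × ℂⁿ` are represented by functions of a matrix and a vector; only their values
at points with `T ∈ ℍ_n` matter. -/
def slash (k m : ℕ) (γ : JacobiGroup n R) (Φ : Matrix (Fin n) (Fin n) ℂ → (Fin n → ℂ) → ℂ)
    (T : Matrix (Fin n) (Fin n) ℂ) (Z : Fin n → ℂ) : ℂ :=
  (γ.cocycle k m T Z)⁻¹ * Φ (γ.actT T) (γ.actZ T Z)

end JacobiGroup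

/-- An index of a degree `2` Fourier expansion: the half-integral matrix
`N = (n₁₁, n₁₂/2; n₁₂/2, n₂₂)` together with `R = (r₁, r₂)`. -/
@[ext]
structure FourierIndex where
  n₁₁ : ℤ
  n₁₂ : ℤ
  n₂₂ : ℤ
  r₁ : ℤ
  r₂ : ℤ

namespace FourierIndex

/-- The matrix `N`. -/
def N (x : FourierIndex) : Matrix (Fin 2) (Fin 2) ℂ :=
  !![(x.n₁₁ : ℂ), (x.n₁₂ : ℂ) / 2; (x.n₁₂ : ℂ) / 2, (x.n₂₂ : ℂ)]

/-- The row `R`. -/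
def R (x : FourierIndex) : Fin 2 → ℂ := ![(x.r₁ : ℂ), (x.r₂ : ℂ)]

/-- The half-integral matrix `(N, Rᵗ/2; R/2, m)` of size `3`. -/
def fullMatrix (m : ℕ) (x : FourierIndex) : Matrix (Fin 3) (Fin 3) ℝ :=
  !![(x.n₁₁ : ℝ), (x.n₁₂ : ℝ) / 2, (x.r₁ : ℝ) / 2;
     (x.n₁₂ : ℝ) / 2, (x.n₂₂ : ℝ), (x.r₂ : ℝ) / 2;
     (x.r₁ : ℝ) / 2, (x.r₂ : ℝ) / 2, (m : ℝ)]

/-- The invariant `D₁`. -/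
def D₁ (m : ℕ) (x : FourierIndex) : ℚ :=
  -4 * Matrix.det !![(x.n₁₁ : ℚ), (x.r₁ : ℚ) / 2; (x.r₁ : ℚ) / 2, (m : ℚ)]

/-- The invariant `D₂`. -/
def D₂ (m : ℕ) (x : FourierIndex) : ℚ :=
  -4 * Matrix.det !![(x.n₂₂ : ℚ), (x.r₂ : ℚ) / 2; (x.r₂ : ℚ) / 2, (m : ℚ)]

/-- The invariant `D`. -/
def D (m : ℕ) (x : FourierIndex) : ℚ :=
  -4 * Matrix.det !![(x.n₁₂ : ℚ) / 2, (x.r₁ : ℚ) / 2; (x.r₂ : ℚ) / 2, (m : ℚ)]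

end FourierIndex

/-- `Φ` has on `ℍ_2 × ℂ²` the (absolutely convergent) Fourier expansion
`Φ(T, Z) = ∑ C(N, R) exp(2 π i (tr(N T) + R Zᵗ))`, the sum being over those `(N, R)` for which
`(N, Rᵗ/2; R/2, m)` is positive semidefinite (`C` is extended by zero to the other indices). -/
structure HasFourierExpansion (m : ℕ) (Φ : Matrix (Fin 2) (Fin 2) ℂ → (Fin 2 → ℂ) → ℂ)
    (C : FourierIndex → ℂ) : Prop where
  eq_zero : ∀ x : FourierIndex, ¬ (x.fullMatrix m).PosSemidef → C x = 0
  hasSum : ∀ T ∈ siegelUpperHalfSpace 2, ∀ Z : Fin 2 → ℂ,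
    HasSum (fun x : FourierIndex => C x * e ((x.N * T).trace + x.R ⬝ᵥ Z)) (Φ T Z)

/-- `Φ ∈ J_{k,m}^2`: `Φ` is a Jacobi form of degree `2`, weight `k` and index `m`. -/
structure IsJacobiForm (k m : ℕ) (Φ : Matrix (Fin 2) (Fin 2) ℂ → (Fin 2 → ℂ) → ℂ) : Prop where
  slash_eq : ∀ γ : JacobiGroup 2 ℤ, ∀ T ∈ siegelUpperHalfSpace 2, ∀ Z : Fin 2 → ℂ,
    γ.slash k m Φ T Z = Φ T Z
  fourier : ∃ C : FourierIndex → ℂ, HasFourierExpansion m Φ C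

open Classical in
/-- `C_{r₁,r₂}(D₁, D₂, D) = C(N, R)`, where `(N, R)` is any index with these invariants and with
`R ≡ (r₁, r₂)` modulo `2m` (for the coefficients of a Jacobi form the value does not depend on
the choice); it is `0` if there is no such index, in particular if one of `D₁`, `D₂`, `D` is
not an integer. -/
def coeff (m : ℕ) (C : FourierIndex → ℂ) (r₁ r₂ : ZMod (2 * m)) (D₁ D₂ D : ℚ) : ℂ :=
  if h : ∃ x : FourierIndex, (x.r₁ : ZMod (2 * m)) = r₁ ∧ (x.r₂ : ZMod (2 * m)) = r₂ ∧
      x.D₁ m = D₁ ∧ x.D₂ m = D₂ ∧ x.D m = D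
  then C h.choose else 0

/-- The Hecke duality relation at `p`. Here `(p : ZMod (2 * m))⁻¹` is the inverse of `p`
modulo `2m`, and `legendreSym p D` is the Legendre symbol `(D / p)`. -/
def HeckeDualityRelation (k m p : ℕ) [Fact p.Prime] (C : FourierIndex → ℂ) : Prop :=
  ∀ (D₁ D₂ D : ℤ) (r₁ r₂ : ZMod (2 * m)),
    ((legendreSym p D₁ : ℂ) - (legendreSym p D₂ : ℂ)) * coeff m C r₁ r₂ D₁ D₂ D =
      (p : ℂ) ^ (2 - (k : ℤ)) *
        (coeff m C r₁ (p * r₂) D₁ (D₂ * p ^ 2) (D * p) -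
          coeff m C (p * r₁) r₂ (D₁ * p ^ 2) D₂ (D * p)) +
      (p : ℂ) ^ ((k : ℤ) - 1) *
        (coeff m C r₁ ((p : ZMod (2 * m))⁻¹ * r₂) D₁ (D₂ / p ^ 2) (D / p) -
          coeff m C ((p : ZMod (2 * m))⁻¹ * r₁) r₂ (D₁ / p ^ 2) D₂ (D / p))

/-- `Φ ∈ 𝔼_{k,m}^{(p)}`: `Φ` is a Jacobi form whose Fourier coefficients satisfy the Hecke duality
relation at `p`. -/
def MemHeckeDuality (k m p : ℕ) [Fact p.Prime]
    (Φ : Matrix (Fin 2) (Fin 2) ℂ → (Fin 2 → ℂ) → ℂ) : Prop :=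
  IsJacobiForm k m Φ ∧
    ∃ C : FourierIndex → ℂ, HasFourierExpansion m Φ C ∧ HeckeDualityRelation k m p C

/-- The embedding `Sp_1(R) × Sp_1(R) → Sp_2(R)`, where `Sp_1 = SL_2`. -/
def spProd {R : Type} [CommRing R] (g g' : Matrix.SpecialLinearGroup (Fin 2) R) :
    Matrix.symplecticGroup (Fin 2) R :=
  ⟨Matrix.fromBlocks (Matrix.diagonal ![g.1 0 0, g'.1 0 0]) (Matrix.diagonal ![g.1 0 1, g'.1 0 1])
      (Matrix.diagonal ![g.1 1 0, g'.1 1 0]) (Matrix.diagonal ![g.1 1 1, g'.1 1 1]), by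
    have h := Matrix.det_fin_two g.1
    have h' := Matrix.det_fin_two g'.1
    rw [g.2] at h
    rw [g'.2] at h'
    rw [SymplecticGroup.mem_iff, Matrix.J, Matrix.fromBlocks_transpose,
      Matrix.fromBlocks_multiply, Matrix.fromBlocks_multiply]
    congr 1 <;> ext i j <;> fin_cases i <;> fin_cases j <;>
      simp <;> grind⟩

/-- `γ^↑ = γ × 1` for `γ = (g, (l, u, κ))` in the degree one Jacobi group
`SL_2(R) ⋉ H_1(R)`. -/
def up {R : Type} [CommRing R] (g : Matrix.SpecialLinearGroup (Fin 2) R) (l u κ : R) :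
    JacobiGroup 2 R :=
  ⟨spProd g 1, ![l, 0], ![u, 0], κ⟩

/-- `γ^↓ = 1 × γ`. -/
def down {R : Type} [CommRing R] (g : Matrix.SpecialLinearGroup (Fin 2) R) (l u κ : R) :
    JacobiGroup 2 R :=
  ⟨spProd 1 g, ![0, l], ![0, u], κ⟩

/-- The integral `2 × 2` matrices of determinant `ℓ²`, up to left multiplication by `SL_2(ℤ)`. -/
abbrev HeckeCosets (ℓ : ℕ) : Type :=
  MulAction.orbitRel.Quotient (Matrix.SpecialLinearGroup (Fin 2) ℤ)
    (FixedDetMatrix (Fin 2) ℤ ((ℓ : ℤ) ^ 2))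

/-- There are only finitely many cosets, so that sums over them are honest finite sums. -/
instance finite_heckeCosets (ℓ : ℕ) [NeZero ℓ] : Finite (HeckeCosets ℓ) := by
  have hl : ((ℓ : ℤ) ^ 2) ≠ 0 := pow_ne_zero _ (by exact_mod_cast NeZero.ne ℓ)
  have key : ∀ A : FixedDetMatrix (Fin 2) ℤ ((ℓ : ℤ) ^ 2),
      ∃ B ∈ FixedDetMatrices.reps ((ℓ : ℤ) ^ 2),
        (Quotient.mk'' A : HeckeCosets ℓ) = Quotient.mk'' B := by
    intro A
    induction A using FixedDetMatrices.induction_on hl with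
    | h0 A h1 h2 h3 h4 => exact ⟨A, ⟨h1, h2, h3, h4⟩, rfl⟩
    | hS B hB =>
      obtain ⟨D, hD, h⟩ := hB
      exact ⟨D, hD, (Quotient.eq''.2 (MulAction.orbitRel_apply.2 ⟨_, rfl⟩)).trans h⟩
    | hT B hB =>
      obtain ⟨D, hD, h⟩ := hB
      exact ⟨D, hD, (Quotient.eq''.2 (MulAction.orbitRel_apply.2 ⟨_, rfl⟩)).trans h⟩
  refine Finite.of_surjective
    (fun B : FixedDetMatrices.reps ((ℓ : ℤ) ^ 2) => (Quotient.mk'' B.1 : HeckeCosets ℓ)) ?_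
  intro q
  induction q using Quotient.inductionOn' with
  | h A =>
    obtain ⟨B, hB, h⟩ := key A
    exact ⟨⟨B, hB⟩, h.symm⟩

/-- The greatest common divisor of the entries of a matrix. -/
def entriesGcd (M : Matrix (Fin 2) (Fin 2) ℤ) : ℕ :=
  Nat.gcd (Int.gcd (M 0 0) (M 0 1)) (Int.gcd (M 1 0) (M 1 1))

/-- `(1/ℓ) M ∈ SL_2(ℚ)` for an integral matrix `M` of determinant `ℓ²`. -/
def scaled (ℓ : ℕ) [NeZero ℓ] (M : FixedDetMatrix (Fin 2) ℤ ((ℓ : ℤ) ^ 2)) :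
    Matrix.SpecialLinearGroup (Fin 2) ℚ :=
  ⟨(ℓ : ℚ)⁻¹ • M.1.map (Int.cast : ℤ → ℚ), by
    have h : (ℓ : ℚ) ≠ 0 := NeZero.ne _
    have h2 : (M.1.map (Int.cast : ℤ → ℚ)).det = (ℓ : ℚ) ^ 2 := by
      have h3 := Int.cast_det (R := ℚ) M.1
      rw [M.2] at h3
      simpa using h3.symm
    rw [Matrix.det_smul, h2]
    simp [h]⟩

/-- The operator
`Φ ↦ ℓ^(k-4) ∑_M ∑_{(l,u) ∈ ℤ²/ℓℤ²} Φ |_{k,m} ι((1/ℓ) M, (l, u, 0))`, where `M` runs over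
representatives of the cosets `SL_2(ℤ) \ {M ∈ Mat_2(ℤ) : det M = ℓ², gcd(M) a square}` (a finite
set), and `ι` is one of the two embeddings of the degree one Jacobi group. -/
def heckeOperator (k m ℓ : ℕ) [NeZero ℓ]
    (ι : Matrix.SpecialLinearGroup (Fin 2) ℚ → ℚ → ℚ → ℚ → JacobiGroup 2 ℚ)
    (Φ : Matrix (Fin 2) (Fin 2) ℂ → (Fin 2 → ℂ) → ℂ)
    (T : Matrix (Fin 2) (Fin 2) ℂ) (Z : Fin 2 → ℂ) : ℂ :=
  (ℓ : ℂ) ^ ((k : ℤ) - 4) *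
    ∑ᶠ (q : HeckeCosets ℓ) (_ : IsSquare (entriesGcd q.out.1)),
      ∑ l ∈ Finset.range ℓ, ∑ u ∈ Finset.range ℓ,
        (ι (scaled ℓ q.out) l u 0).slash k m Φ T Z

/-- `Φ | T^J(ℓ)^↑`. -/
def heckeUp (k m ℓ : ℕ) [NeZero ℓ] (Φ : Matrix (Fin 2) (Fin 2) ℂ → (Fin 2 → ℂ) → ℂ) :
    Matrix (Fin 2) (Fin 2) ℂ → (Fin 2 → ℂ) → ℂ :=
  heckeOperator k m ℓ up Φ

/-- `Φ | T^J(ℓ)^↓`. -/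
def heckeDown (k m ℓ : ℕ) [NeZero ℓ] (Φ : Matrix (Fin 2) (Fin 2) ℂ → (Fin 2 → ℂ) → ℂ) :
    Matrix (Fin 2) (Fin 2) ℂ → (Fin 2 → ℂ) → ℂ :=
  heckeOperator k m ℓ down Φ

end HeckeJacobi

end

/-!
The operators `T^J(p)^↑` and `T^J(p)^↓` are compared through Fourier coefficients, in the
coordinates `(τ, z, w, x, y)` of the point `((τ, z; z, w), (x, y))`. Interchanging the two diagonal
variables carries `↓` to `↑`, so only the upper operator has to be analysed. The matrices of
determinant `p²` whose gcd is a square are the primitive ones, with representatives `(p², 0; 0, 1)`,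
`(p, b; 0, p)` for `0 < b < p` and `(1, b; 0, p²)` for `0 ≤ b < p²` (`finsum_cosets_eq`).

The Fourier expansion of `Φ | T^J(p)^↑` has exponents `n₁₂ z / p`, and those with `p ∤ n₁₂` are not
seen by the duality relation. Averaging over `z ↦ z + j`, `0 ≤ j < p`, removes them. The remaining
coefficients are computed in `CoordJacobiForm.hasSum_heckeSum`: the three types of representatives
contribute the coefficient with the index divided by `p` (each such index arises from one `λ` modulo
`p`), the Legendre symbol of `D₁` (a count of roots of a quadratic polynomial modulo `p`), and the
coefficient with the index multiplied by `p`. Hence the duality relation says precisely that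
`f = Φ | (T^J(p)^↑ - T^J(p)^↓)` has average zero, by the uniqueness of Fourier coefficients
(`fourier_eq_zero`); for invariants that belong to no index all terms of the relation vanish, since
`p` is prime to `2m`. This shows that `f = 0` implies the relation.

Conversely, let the average of `f` vanish. The function `f` is invariant under `τ ↦ -1/τ`,
`τ ↦ τ + 1`, `w ↦ w + 1` and `z ↦ z + p`: the generators of the embedded groups `SL₂(ℤ)` permute the cosets
in one operator and commute with those in the other. Transporting the vanishing of the average by
these substitutions gives enough linear relations between the translates of `f` to conclude that
`f = 0` (`eq_zero_of_sum_translates`).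
-/

noncomputable section

namespace HeckeJacobi

/-! ### Uniqueness of absolutely convergent Fourier series -/

open UnitAddTorus in
theorem mFourier_coeff_eq_zero {d : Type} [Fintype d] (b : (d → ℤ) → ℂ)
    (hb : Summable fun n => ‖b n‖)
    (h : ∀ t : d → ℝ, HasSum (fun n => b n * mFourier n (fun i => (t i : UnitAddCircle))) 0)
    (n : d → ℤ) : b n = 0 := by
  classical
  have hs : Summable fun n => b n • mFourier (d := d) n := by
    refine Summable.of_norm ?_
    simpa [norm_smul, mFourier_norm] using hb
  have h0 : HasSum (fun n => b n • mFourier (d := d) n) 0 := by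
    have h1 := hs.hasSum
    convert h1
    ext x
    obtain ⟨t, rfl⟩ : ∃ t : d → ℝ, x = fun i => (t i : UnitAddCircle) :=
      ⟨fun i => (x i).out, by ext i; simp⟩
    have h2 := ContinuousMap.hasSum_apply h1 (fun i => (t i : UnitAddCircle))
    simp only [ContinuousMap.smul_apply, smul_eq_mul] at h2
    simpa using (h t).unique h2
  -- The sum converges uniformly, hence in `L²`, where the monomials are orthonormal.
  let ν := MeasureTheory.Measure.pi
    fun _ : d => (AddCircle.haarAddCircle : MeasureTheory.Measure UnitAddCircle)
  have h3 := h0.mapL (ContinuousMap.toLp (E := ℂ) 2 ν ℂ)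
  have ho : Orthonormal ℂ (fun n => ContinuousMap.toLp (E := ℂ) 2 ν ℂ (mFourier (d := d) n)) :=
    orthonormal_mFourier (d := d)
  have h4 := h3.mapL (innerSL ℂ (ContinuousMap.toLp (E := ℂ) 2 ν ℂ (mFourier (d := d) n)))
  have h5 := orthonormal_iff_ite.1 ho n
  simp only [map_smul, innerSL_apply_apply, map_zero, smul_eq_mul, h5, mul_ite, mul_one,
    mul_zero] at h4
  have h6 : (fun i => if n = i then b i else 0) = fun i => if i = n then b n else 0 := by
    funext i
    by_cases hi : i = n
    · rw [hi]
    · rw [if_neg hi, if_neg (Ne.symm hi)]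
  rw [h6] at h4
  exact (hasSum_ite_eq n (b n)).unique h4

/-! ### Coordinates on `ℍ₂ × ℂ²` -/

theorem e_add (a b : ℂ) : e (a + b) = e a * e b := by
  simp [e, mul_add, Complex.exp_add]

theorem e_neg (a : ℂ) : e (-a) = (e a)⁻¹ := by
  simp [e, Complex.exp_neg]

theorem e_ne_zero (a : ℂ) : e a ≠ 0 := Complex.exp_ne_zero _

@[simp]
theorem e_zero : e 0 = 1 := by simp [e]

@[simp]
theorem e_intCast (n : ℤ) : e n = 1 :=
  Complex.exp_eq_one_iff.2 ⟨n, by ring⟩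

theorem e_add_intCast (a : ℂ) (n : ℤ) : e (a + n) = e a := by
  rw [e_add, e_intCast, mul_one]

/-- `(τ, z; z, w)` lies in `ℍ₂`. -/
structure InH (τ z w : ℂ) : Prop where
  im_pos : 0 < τ.im
  im_sq_lt : z.im ^ 2 < τ.im * w.im

theorem posDef_fin_two_iff (a b c : ℝ) :
    (!![a, b; b, c] : Matrix (Fin 2) (Fin 2) ℝ).PosDef ↔ 0 < a ∧ b ^ 2 < a * c := by
  constructor
  · intro h
    have h1 := h.det_pos
    have h2 := h.diag_pos (i := 0)
    simp only [Matrix.det_fin_two, Matrix.of_apply, Matrix.cons_val', Matrix.cons_val_zero,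
      Matrix.cons_val_fin_one, Matrix.cons_val_one] at h1 h2
    exact ⟨h2, by nlinarith⟩
  · rintro ⟨h1, h2⟩
    refine Matrix.PosDef.of_dotProduct_mulVec_pos ?_ ?_
    · ext i j; fin_cases i <;> fin_cases j <;> simp
    · intro x hx
      have hne : x 0 ≠ 0 ∨ x 1 ≠ 0 := by
        by_contra! h
        exact hx (by ext i; fin_cases i <;> simp [h])
      have key : 0 < a * (x 0 * (a * x 0 + b * x 1) + x 1 * (b * x 0 + c * x 1)) := by
        have : a * (x 0 * (a * x 0 + b * x 1) + x 1 * (b * x 0 + c * x 1)) =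
            (a * x 0 + b * x 1) ^ 2 + (a * c - b ^ 2) * x 1 ^ 2 := by ring
        rw [this]
        by_cases h : x 1 = 0
        · simp_all
          positivity
        · have : 0 < (a * c - b ^ 2) * x 1 ^ 2 := mul_pos (by linarith) (by positivity)
          positivity
      have := pos_of_mul_pos_right key h1.le
      simpa [Matrix.mulVec, dotProduct, Fin.sum_univ_two] using this

theorem mem_siegelUpperHalfSpace_iff (τ z w : ℂ) :
    !![τ, z; z, w] ∈ siegelUpperHalfSpace 2 ↔ InH τ z w := by
  have h1 : (!![τ, z; z, w] : Matrix (Fin 2) (Fin 2) ℂ).transpose = !![τ, z; z, w] := by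
    ext i j; fin_cases i <;> fin_cases j <;> rfl
  have h2 : (!![τ, z; z, w] : Matrix (Fin 2) (Fin 2) ℂ).map Complex.im =
      !![τ.im, z.im; z.im, w.im] := by
    ext i j; fin_cases i <;> fin_cases j <;> rfl
  rw [siegelUpperHalfSpace, Set.mem_ofPred_eq, h2, posDef_fin_two_iff]
  exact ⟨fun h => ⟨h.2.1, h.2.2⟩, fun h => ⟨h1, h.1, h.2⟩⟩

theorem exists_of_mem_siegelUpperHalfSpace {T : Matrix (Fin 2) (Fin 2) ℂ}
    (hT : T ∈ siegelUpperHalfSpace 2) :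
    ∃ τ z w, InH τ z w ∧ T = !![τ, z; z, w] := by
  have h : T = !![T 0 0, T 0 1; T 0 1, T 1 1] := by
    have h1 : T 1 0 = T 0 1 := congrFun (congrFun hT.1 0) 1
    ext i j; fin_cases i <;> fin_cases j <;> simp [h1]
  exact ⟨_, _, _, (mem_siegelUpperHalfSpace_iff _ _ _).1 (h ▸ hT), h⟩

namespace InH

variable {τ z w : ℂ}

theorem symm (h : InH τ z w) : InH w z τ := by
  have h1 := h.im_pos
  have h2 := h.im_sq_lt
  have h3 : 0 < τ.im * w.im := (sq_nonneg _).trans_lt h2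
  exact ⟨pos_of_mul_pos_right h3 h1.le, by linarith⟩

theorem add_real (h : InH τ z w) {a b c : ℂ} (ha : a.im = 0) (hb : b.im = 0) (hc : c.im = 0) :
    InH (τ + a) (z + b) (w + c) := by
  refine ⟨?_, ?_⟩
  · simpa [ha] using h.im_pos
  · simpa [ha, hb, hc] using h.im_sq_lt

theorem add_int (h : InH τ z w) (a b c : ℤ) : InH (τ + a) (z + b) (w + c) :=
  h.add_real (by simp) (by simp) (by simp)

theorem shear (h : InH τ z w) (s : ℤ) : InH τ (z + s * τ) (w + 2 * s * z + s ^ 2 * τ) := by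
  refine ⟨h.im_pos, ?_⟩
  have e1 : (z + s * τ).im = z.im + s * τ.im := by simp
  have e2 : (w + 2 * s * z + s ^ 2 * τ).im = w.im + 2 * s * z.im + s ^ 2 * τ.im := by
    have h1 : ((s : ℂ) ^ 2 * τ).im = (s : ℝ) ^ 2 * τ.im := by
      have : ((s : ℂ) ^ 2) = (((s : ℝ) ^ 2 : ℝ) : ℂ) := by push_cast; rfl
      rw [this, Complex.im_ofReal_mul]
    have h2 : ((2 : ℂ) * s * z).im = 2 * (s : ℝ) * z.im := by
      have : (2 : ℂ) * s = ((2 * (s : ℝ) : ℝ) : ℂ) := by push_cast; rfl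
      rw [this, Complex.im_ofReal_mul]
    simp only [Complex.add_im, h1, h2]
  rw [e1, e2]
  nlinarith [h.im_sq_lt]

end InH

/-! ### The slash operator in coordinates -/

/-- Functions of the coordinates `(τ, z, w, x, y)` of the point `((τ, z; z, w), (x, y))`. -/
abbrev CoordFun : Type := ℂ → ℂ → ℂ → ℂ → ℂ → ℂ

/-- A function on `ℍ₂ × ℂ²` in coordinates. -/
def toCoord (Φ : Matrix (Fin 2) (Fin 2) ℂ → (Fin 2 → ℂ) → ℂ) : CoordFun :=
  fun τ z w x y => Φ !![τ, z; z, w] ![x, y]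

/-- Interchange of the two diagonal variables. It carries the embedding `↓` to the
embedding `↑`. -/
def flip (φ : CoordFun) : CoordFun := fun τ z w x y => φ w z τ y x

/-- The slash operator of `(G, 0)^↑` in coordinates. -/
def slashMat (k m : ℕ) (G : Matrix (Fin 2) (Fin 2) ℂ) (φ : CoordFun) : CoordFun :=
  fun τ z w x y =>
    ((G 1 0 * τ + G 1 1) ^ k * e (m * (G 1 0 * x ^ 2 / (G 1 0 * τ + G 1 1))))⁻¹ *
      φ ((G 0 0 * τ + G 0 1) / (G 1 0 * τ + G 1 1)) (z / (G 1 0 * τ + G 1 1))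
        (w - G 1 0 * z ^ 2 / (G 1 0 * τ + G 1 1)) (x / (G 1 0 * τ + G 1 1))
        (y - G 1 0 * z * x / (G 1 0 * τ + G 1 1))

/-- The slash operator of `(1, (l, u, 0))^↑` in coordinates. -/
def slashHeis (m : ℕ) (l u : ℂ) (φ : CoordFun) : CoordFun :=
  fun τ z w x y =>
    e (m * (l ^ 2 * τ + 2 * l * x + u * l)) * φ τ z w (x + l * τ + u) (y + l * z)

section Slash

variable {R : Type} [CommRing R] [Algebra R ℂ]

/-- The complex matrix underlying an element of `SL₂(R)`. -/
def toMatC (g : Matrix.SpecialLinearGroup (Fin 2) R) : Matrix (Fin 2) (Fin 2) ℂ :=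
  g.1.map (algebraMap R ℂ)

theorem slash_up_eq (k m : ℕ) (g : Matrix.SpecialLinearGroup (Fin 2) R) (l u : R)
    (Φ : Matrix (Fin 2) (Fin 2) ℂ → (Fin 2 → ℂ) → ℂ) (τ z w x y : ℂ)
    (hj : toMatC g 1 0 * τ + toMatC g 1 1 ≠ 0) (hdet : (toMatC g).det = 1) :
    (up g l u 0).slash k m Φ !![τ, z; z, w] ![x, y] =
      slashHeis m (algebraMap R ℂ l) (algebraMap R ℂ u) (slashMat k m (toMatC g) (toCoord Φ))
        τ z w x y := by
  set a := toMatC g 0 0 with ha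
  set b := toMatC g 0 1 with hb
  set c := toMatC g 1 0 with hc
  set d := toMatC g 1 1 with hd
  have hA : (up g l u 0).A = !![a, 0; 0, 1] := by
    ext i j; fin_cases i <;> fin_cases j <;> simp [JacobiGroup.A, up, spProd, ha, toMatC]
  have hB : (up g l u 0).B = !![b, 0; 0, 0] := by
    ext i j; fin_cases i <;> fin_cases j <;> simp [JacobiGroup.B, up, spProd, hb, toMatC]
  have hC : (up g l u 0).C = !![c, 0; 0, 0] := by
    ext i j; fin_cases i <;> fin_cases j <;> simp [JacobiGroup.C, up, spProd, hc, toMatC]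
  have hD : (up g l u 0).D = !![d, 0; 0, 1] := by
    ext i j; fin_cases i <;> fin_cases j <;> simp [JacobiGroup.D, up, spProd, hd, toMatC]
  have hl : (up g l u 0).lamC = ![algebraMap R ℂ l, 0] := by
    ext i; fin_cases i <;> simp [JacobiGroup.lamC, up]
  have hu : (up g l u 0).muC = ![algebraMap R ℂ u, 0] := by
    ext i; fin_cases i <;> simp [JacobiGroup.muC, up]
  have hκ : (up g l u 0).kapC = 0 := by simp [JacobiGroup.kapC, up]
  generalize algebraMap R ℂ l = L at *
  generalize algebraMap R ℂ u = U at *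
  have hden : (up g l u 0).denom !![τ, z; z, w] = !![c * τ + d, c * z; 0, 1] := by
    rw [JacobiGroup.denom, hC, hD]
    ext i j; fin_cases i <;> fin_cases j <;> simp
  have hinv : (!![c * τ + d, c * z; 0, 1] : Matrix (Fin 2) (Fin 2) ℂ)⁻¹ =
      !![1 / (c * τ + d), -(c * z) / (c * τ + d); 0, 1] := by
    refine Matrix.inv_eq_right_inv ?_
    ext i j; fin_cases i <;> fin_cases j <;> simp <;> field_simp
    ring
  have hZ : (up g l u 0).heisZ !![τ, z; z, w] ![x, y] =
      ![x + L * τ + U, y + L * z] := by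
    rw [JacobiGroup.heisZ, hl, hu]
    ext i; fin_cases i <;> simp
  have hdet' : a * d - b * c = 1 := by rw [← hdet, Matrix.det_fin_two]
  have hj' : τ * c + d ≠ 0 := by rwa [mul_comm]
  have hT' : (up g l u 0).actT !![τ, z; z, w] =
      !![(a * τ + b) / (c * τ + d), z / (c * τ + d); z / (c * τ + d),
        w - c * z ^ 2 / (c * τ + d)] := by
    rw [JacobiGroup.actT, hden, hinv, hA, hB]
    ext i j; fin_cases i <;> fin_cases j <;>
      simp [Matrix.mul_apply, Fin.sum_univ_two] <;> field_simp
    · linear_combination z * hdet'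
    · ring
  have hZ' : (up g l u 0).actZ !![τ, z; z, w] ![x, y] =
      ![(x + L * τ + U) / (c * τ + d),
        y + L * z - c * z * (x + L * τ + U) /
          (c * τ + d)] := by
    rw [JacobiGroup.actZ, hden, hinv, hZ]
    ext i; fin_cases i <;> simp <;> field_simp
    ring
  rw [JacobiGroup.slash, JacobiGroup.cocycle, hT', hZ', hden, hinv, hZ, hC, hl, hu, hκ]
  simp only [slashHeis, slashMat, toCoord, e_neg, mul_inv, inv_inv]
  simp only [← ha, ← hb, ← hc, ← hd]
  have e1 : (!![c * τ + d, c * z; 0, 1] : Matrix (Fin 2) (Fin 2) ℂ).det = c * τ + d := by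
    simp [Matrix.det_fin_two]
  rw [e1]
  have e2 : (![x + L * τ + U, y + L * z] ⬝ᵥ
      Matrix.mulVec (!![1 / (c * τ + d), -(c * z) / (c * τ + d); 0, 1] * !![c, 0; 0, 0])
        ![x + L * τ + U, y + L * z]) =
      c * (x + L * τ + U) ^ 2 / (c * τ + d) := by
    simp [Matrix.mul_apply, dotProduct, Matrix.mulVec, Fin.sum_univ_two]
    field_simp
  have e3 : (![L, 0] ⬝ᵥ Matrix.mulVec !![τ, z; z, w] ![L, 0] +
      2 * (![L, 0] ⬝ᵥ ![x, y]) + 0 +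
      ![U, 0] ⬝ᵥ ![L, 0]) =
      L ^ 2 * τ + 2 * L * x +
        U * L := by
    simp [dotProduct, Matrix.mulVec, Fin.sum_univ_two]
    ring
  rw [e2, e3]
  ring

theorem slash_down_eq (k m : ℕ) (g : Matrix.SpecialLinearGroup (Fin 2) R) (l u : R)
    (Φ : Matrix (Fin 2) (Fin 2) ℂ → (Fin 2 → ℂ) → ℂ) (τ z w x y : ℂ)
    (hj : toMatC g 1 0 * w + toMatC g 1 1 ≠ 0) (hdet : (toMatC g).det = 1) :
    (down g l u 0).slash k m Φ !![τ, z; z, w] ![x, y] =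
      slashHeis m (algebraMap R ℂ l) (algebraMap R ℂ u)
        (slashMat k m (toMatC g) (flip (toCoord Φ))) w z τ y x := by
  set a := toMatC g 0 0 with ha
  set b := toMatC g 0 1 with hb
  set c := toMatC g 1 0 with hc
  set d := toMatC g 1 1 with hd
  have hA : (down g l u 0).A = !![1, 0; 0, a] := by
    ext i j; fin_cases i <;> fin_cases j <;> simp [JacobiGroup.A, down, spProd, ha, toMatC]
  have hB : (down g l u 0).B = !![0, 0; 0, b] := by
    ext i j; fin_cases i <;> fin_cases j <;> simp [JacobiGroup.B, down, spProd, hb, toMatC]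
  have hC : (down g l u 0).C = !![0, 0; 0, c] := by
    ext i j; fin_cases i <;> fin_cases j <;> simp [JacobiGroup.C, down, spProd, hc, toMatC]
  have hD : (down g l u 0).D = !![1, 0; 0, d] := by
    ext i j; fin_cases i <;> fin_cases j <;> simp [JacobiGroup.D, down, spProd, hd, toMatC]
  have hl : (down g l u 0).lamC = ![0, algebraMap R ℂ l] := by
    ext i; fin_cases i <;> simp [JacobiGroup.lamC, down]
  have hu : (down g l u 0).muC = ![0, algebraMap R ℂ u] := by
    ext i; fin_cases i <;> simp [JacobiGroup.muC, down]
  have hκ : (down g l u 0).kapC = 0 := by simp [JacobiGroup.kapC, down]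
  generalize algebraMap R ℂ l = L at *
  generalize algebraMap R ℂ u = U at *
  have hden : (down g l u 0).denom !![τ, z; z, w] = !![1, 0; c * z, c * w + d] := by
    rw [JacobiGroup.denom, hC, hD]
    ext i j; fin_cases i <;> fin_cases j <;> simp
  have hinv : (!![1, 0; c * z, c * w + d] : Matrix (Fin 2) (Fin 2) ℂ)⁻¹ =
      !![1, 0; -(c * z) / (c * w + d), 1 / (c * w + d)] := by
    refine Matrix.inv_eq_right_inv ?_
    ext i j; fin_cases i <;> fin_cases j <;> simp <;> field_simp
    ring
  have hZ : (down g l u 0).heisZ !![τ, z; z, w] ![x, y] =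
      ![x + L * z, y + L * w + U] := by
    rw [JacobiGroup.heisZ, hl, hu]
    ext i; fin_cases i <;> simp
  have hdet' : a * d - b * c = 1 := by rw [← hdet, Matrix.det_fin_two]
  have hj' : w * c + d ≠ 0 := by rwa [mul_comm]
  have hT' : (down g l u 0).actT !![τ, z; z, w] =
      !![τ - c * z ^ 2 / (c * w + d), z / (c * w + d); z / (c * w + d),
        (a * w + b) / (c * w + d)] := by
    rw [JacobiGroup.actT, hden, hinv, hA, hB]
    ext i j; fin_cases i <;> fin_cases j <;> simp <;> field_simp
    · ring
    · linear_combination z * hdet'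
  have hZ' : (down g l u 0).actZ !![τ, z; z, w] ![x, y] =
      ![x + L * z - c * z * (y + L * w + U) /
          (c * w + d),
        (y + L * w + U) / (c * w + d)] := by
    rw [JacobiGroup.actZ, hden, hinv, hZ]
    ext i; fin_cases i <;> simp <;> field_simp
    ring
  rw [JacobiGroup.slash, JacobiGroup.cocycle, hT', hZ', hden, hinv, hZ, hC, hl, hu, hκ]
  simp only [slashHeis, slashMat, toCoord, flip, e_neg, mul_inv, inv_inv]
  simp only [← ha, ← hb, ← hc, ← hd]
  have e1 : (!![1, 0; c * z, c * w + d] : Matrix (Fin 2) (Fin 2) ℂ).det = c * w + d := by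
    simp [Matrix.det_fin_two]
  rw [e1]
  have e2 : (![x + L * z, y + L * w + U] ⬝ᵥ
      Matrix.mulVec (!![1, 0; -(c * z) / (c * w + d), 1 / (c * w + d)] * !![0, 0; 0, c])
        ![x + L * z, y + L * w + U]) =
      c * (y + L * w + U) ^ 2 / (c * w + d) := by
    simp [Matrix.mul_apply, dotProduct, Matrix.mulVec, Fin.sum_univ_two]
    field_simp
  have e3 : (![0, L] ⬝ᵥ Matrix.mulVec !![τ, z; z, w] ![0, L] +
      2 * (![0, L] ⬝ᵥ ![x, y]) + 0 +
      ![0, U] ⬝ᵥ ![0, L]) =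
      L ^ 2 * w + 2 * L * y +
        U * L := by
    simp [dotProduct, Matrix.mulVec, Fin.sum_univ_two]
    ring
  rw [e2, e3]
  ring

end Slash

/-- Complex matrices that come from `SL₂(ℝ)`. -/
structure IsRealSL (G : Matrix (Fin 2) (Fin 2) ℂ) : Prop where
  im_eq_zero : ∀ i j, (G i j).im = 0
  det_eq_one : G 0 0 * G 1 1 - G 0 1 * G 1 0 = 1

namespace IsRealSL

variable {G G' : Matrix (Fin 2) (Fin 2) ℂ} {τ z w : ℂ}

theorem mul (hG : IsRealSL G) (hG' : IsRealSL G') : IsRealSL (G * G') := by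
  constructor
  · intro i j
    simp [Matrix.mul_apply, Fin.sum_univ_two, hG.im_eq_zero, hG'.im_eq_zero]
  · simp only [Matrix.mul_apply, Fin.sum_univ_two]
    linear_combination (G' 0 0 * G' 1 1 - G' 0 1 * G' 1 0) * hG.det_eq_one + hG'.det_eq_one

theorem exists_real (hG : IsRealSL G) : ∃ a b c d : ℝ, a * d - b * c = 1 ∧
    G 0 0 = a ∧ G 0 1 = b ∧ G 1 0 = c ∧ G 1 1 = d := by
  have h : ∀ i j, G i j = ((G i j).re : ℂ) := fun i j =>
    Complex.ext (by simp) (by simpa using hG.im_eq_zero i j)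
  refine ⟨(G 0 0).re, (G 0 1).re, (G 1 0).re, (G 1 1).re, ?_, h _ _, h _ _, h _ _, h _ _⟩
  have h1 := hG.det_eq_one
  rw [h 0 0, h 0 1, h 1 0, h 1 1] at h1
  exact_mod_cast h1

theorem denom_ne_zero (hG : IsRealSL G) (hτ : 0 < τ.im) : G 1 0 * τ + G 1 1 ≠ 0 := by
  obtain ⟨a, b, c, d, hdet, h1, h2, h3, h4⟩ := hG.exists_real
  rw [h3, h4]
  intro h
  have hi := congrArg Complex.im h
  have hr := congrArg Complex.re h
  simp only [Complex.add_im, Complex.im_ofReal_mul, Complex.ofReal_im, Complex.zero_im, add_zero,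
    mul_eq_zero, hτ.ne', or_false] at hi
  subst hi
  simp only [Complex.ofReal_zero, zero_mul, zero_add, Complex.ofReal_re, Complex.zero_re] at hr
  subst hr
  simp at hdet

theorem inH (hG : IsRealSL G) (h : InH τ z w) :
    InH ((G 0 0 * τ + G 0 1) / (G 1 0 * τ + G 1 1)) (z / (G 1 0 * τ + G 1 1))
      (w - G 1 0 * z ^ 2 / (G 1 0 * τ + G 1 1)) := by
  have hj := hG.denom_ne_zero h.im_pos
  obtain ⟨a, b, c, d, hdet, h1, h2, h3, h4⟩ := hG.exists_real
  rw [h3, h4] at hj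
  rw [h1, h2, h3, h4]
  set n := Complex.normSq (c * τ + d) with hn
  have hn0 : 0 < n := Complex.normSq_pos.2 hj
  have hn' : n = (c * τ.re + d) ^ 2 + (c * τ.im) ^ 2 := by
    rw [hn, Complex.normSq_apply]; simp; ring
  have e1 : ((a * τ + b) / (c * τ + d)).im = τ.im / n := by
    rw [Complex.div_im, ← hn]
    simp
    field_simp
    linear_combination τ.im * hdet
  have e2 : (z / (c * τ + d)).im = (z.im * (c * τ.re + d) - z.re * (c * τ.im)) / n := by
    rw [Complex.div_im, ← hn]
    simp
    ring
  have e3 : (w - c * z ^ 2 / (c * τ + d)).im = w.im -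
      c * (2 * z.re * z.im * (c * τ.re + d) - (z.re ^ 2 - z.im ^ 2) * (c * τ.im)) / n := by
    rw [Complex.sub_im, Complex.div_im, ← hn]
    simp [sq]
    ring
  refine ⟨?_, ?_⟩
  · rw [e1]; exact div_pos h.im_pos hn0
  · rw [e1, e2, e3]
    have h5 := h.im_sq_lt
    have key : τ.im / n * (w.im - c * (2 * z.re * z.im * (c * τ.re + d) -
        (z.re ^ 2 - z.im ^ 2) * (c * τ.im)) / n) -
        ((z.im * (c * τ.re + d) - z.re * (c * τ.im)) / n) ^ 2 =
        (τ.im * w.im - z.im ^ 2) / n := by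
      field_simp
      rw [hn']
      ring
    have : 0 < (τ.im * w.im - z.im ^ 2) / n := div_pos (by linarith) hn0
    linarith

end IsRealSL

/-- The slash operators form a right action. This is stated for matrices that come from `SL₂(ℝ)`,
for which the denominators do not vanish on `ℍ₂`. -/
theorem slashMat_mul {k m : ℕ} {G G' : Matrix (Fin 2) (Fin 2) ℂ} (hG : IsRealSL G)
    (hG' : IsRealSL G') (φ : CoordFun) {τ z w : ℂ} (h : InH τ z w) (x y : ℂ) :
    slashMat k m (G * G') φ τ z w x y = slashMat k m G' (slashMat k m G φ) τ z w x y := by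
  have hj' := hG'.denom_ne_zero h.im_pos
  have hj := (hG.mul hG').denom_ne_zero h.im_pos
  have hd' := hG'.det_eq_one
  simp only [slashMat]
  simp only [Matrix.mul_apply, Fin.sum_univ_two] at hj ⊢
  set a := G 0 0
  set b := G 0 1
  set c := G 1 0
  set d := G 1 1
  set a' := G' 0 0
  set b' := G' 0 1
  set c' := G' 1 0
  set d' := G' 1 1
  set j' := c' * τ + d' with hj'def
  have e1 : c * ((a' * τ + b') / j') + d = ((c * a' + d * c') * τ + (c * b' + d * d')) / j' := by
    field_simp
    rw [hj'def]; ring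
  set J := (c * a' + d * c') * τ + (c * b' + d * d') with hJ
  have hJ' : J = c * (a' * τ + b') + d * j' := by rw [hJ, hj'def]; ring
  have hd'' : a' * j' - c' * (a' * τ + b') = 1 := by rw [hj'def]; linear_combination hd'
  have key : (c * a' + d * c') * j' = c + c' * J := by
    rw [hJ']; linear_combination c * hd''
  rw [e1]
  have f1 : ((a * a' + b * c') * τ + (a * b' + b * d')) / J =
      (a * ((a' * τ + b') / j') + b) / (J / j') := by
    field_simp
    rw [hj'def]; ring
  have f2 : z / J = z / j' / (J / j') := by field_simp
  have f2' : x / J = x / j' / (J / j') := by field_simp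
  have key' : (c * a' + d * c') = (c + c' * J) / j' := by field_simp; exact key
  have f3 : w - (c * a' + d * c') * z ^ 2 / J =
      w - c' * z ^ 2 / j' - c * (z / j') ^ 2 / (J / j') := by
    rw [key']; field_simp; ring
  have f4 : y - (c * a' + d * c') * z * x / J =
      y - c' * z * x / j' - c * (z / j') * (x / j') / (J / j') := by
    rw [key']; field_simp; ring
  have f5 : e (m * ((c * a' + d * c') * x ^ 2 / J)) =
      e (m * (c' * x ^ 2 / j')) * e (m * (c * (x / j') ^ 2 / (J / j'))) := by
    rw [← e_add, key']
    congr 1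
    field_simp
    ring
  rw [f1, f2, f2', f3, f4, f5, ← mul_assoc (_⁻¹), ← mul_inv]
  have f6 : J ^ k = j' ^ k * (J / j') ^ k := by
    rw [← mul_pow, mul_div_cancel₀ _ hj']
  rw [f6]
  congr 2
  ring

theorem slashHeis_congr (m : ℕ) (l u : ℂ) {φ ψ : CoordFun} {τ z w : ℂ}
    (h : ∀ x y, φ τ z w x y = ψ τ z w x y) (x y : ℂ) :
    slashHeis m l u φ τ z w x y = slashHeis m l u ψ τ z w x y := by
  rw [slashHeis, slashHeis, h]

/-- The commutation rule of the Heisenberg group with `SL₂`. -/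
theorem slashMat_slashHeis {k m : ℕ} {G : Matrix (Fin 2) (Fin 2) ℂ} (hG : IsRealSL G) (l u : ℂ)
    (φ : CoordFun) {τ z w : ℂ} (h : InH τ z w) (x y : ℂ) :
    slashMat k m G (slashHeis m l u φ) τ z w x y =
      slashHeis m (l * G 0 0 + u * G 1 0) (l * G 0 1 + u * G 1 1) (slashMat k m G φ)
        τ z w x y := by
  have hj := hG.denom_ne_zero h.im_pos
  have hd := hG.det_eq_one
  simp only [slashMat, slashHeis]
  set a := G 0 0
  set b := G 0 1
  set c := G 1 0
  set d := G 1 1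
  set J := c * τ + d with hJ
  have f1 : x / J + l * ((a * τ + b) / J) + u =
      (x + (l * a + u * c) * τ + (l * b + u * d)) / J := by
    field_simp
    rw [hJ]; ring
  have f2 : y - c * z * x / J + l * (z / J) =
      y + (l * a + u * c) * z - c * z * (x + (l * a + u * c) * τ + (l * b + u * d)) / J := by
    field_simp
    rw [hJ]; linear_combination (-(z * l)) * hd
  rw [f1, f2, mul_inv, mul_inv, ← e_neg, ← e_neg]
  have f3 : e (-(m * (c * x ^ 2 / J))) *
      e (m * (l ^ 2 * ((a * τ + b) / J) + 2 * l * (x / J) + u * l)) =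
      e (m * ((l * a + u * c) ^ 2 * τ + 2 * (l * a + u * c) * x +
        (l * b + u * d) * (l * a + u * c))) *
      e (-(m * (c * (x + (l * a + u * c) * τ + (l * b + u * d)) ^ 2 / J))) := by
    rw [← e_add, ← e_add]
    congr 1
    field_simp
    rw [hJ]
    linear_combination (-(m * l * (τ * (l * a + u * c) + (l * b + u * d) + 2 * x))) * hd
  linear_combination ((J ^ k)⁻¹ * φ ((a * τ + b) / J) (z / J) (w - c * z ^ 2 / J)
    ((x + (l * a + u * c) * τ + (l * b + u * d)) / J)
    (y + (l * a + u * c) * z - c * z * (x + (l * a + u * c) * τ + (l * b + u * d)) / J)) * f3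

/-! ### Fourier coefficients -/

namespace FourierIndex

/-- The argument `tr(N T) + R Zᵗ` of the exponential function, in coordinates. -/
def phase (n : FourierIndex) (τ z w x y : ℂ) : ℂ :=
  n.n₁₁ * τ + n.n₁₂ * z + n.n₂₂ * w + n.r₁ * x + n.r₂ * y

theorem phase_eq (n : FourierIndex) (τ z w x y : ℂ) :
    (n.N * !![τ, z; z, w]).trace + n.R ⬝ᵥ ![x, y] = n.phase τ z w x y := by
  simp [N, R, phase, Matrix.trace, Fin.sum_univ_two]
  ring

/-- The index with the two diagonal positions interchanged. -/
def flip (n : FourierIndex) : FourierIndex := ⟨n.n₂₂, n.n₁₂, n.n₁₁, n.r₂, n.r₁⟩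

@[simp]
theorem flip_flip (n : FourierIndex) : n.flip.flip = n := rfl

/-- `flip` as a permutation of the indices. -/
def flipEquiv : FourierIndex ≃ FourierIndex := ⟨flip, flip, flip_flip, flip_flip⟩

theorem phase_flip (n : FourierIndex) (τ z w x y : ℂ) :
    n.flip.phase τ z w x y = n.phase w z τ y x := by
  simp only [phase, flip]
  ring

/-- The action of the Heisenberg element `((l, 0), 0, 0)` on the indices. -/
def shift (m : ℕ) (l : ℤ) (n : FourierIndex) : FourierIndex :=
  ⟨n.n₁₁ + n.r₁ * l + m * l ^ 2, n.n₁₂ + n.r₂ * l, n.n₂₂, n.r₁ + 2 * m * l, n.r₂⟩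

theorem shift_neg_shift (m : ℕ) (l : ℤ) (n : FourierIndex) : shift m (-l) (shift m l n) = n := by
  ext <;> simp only [shift] <;> ring

theorem shift_shift_neg (m : ℕ) (l : ℤ) (n : FourierIndex) : shift m l (shift m (-l) n) = n := by
  ext <;> simp only [shift] <;> ring

/-- `shift` as a permutation of the indices. -/
def shiftEquiv (m : ℕ) (l : ℤ) : FourierIndex ≃ FourierIndex :=
  ⟨shift m l, shift m (-l), shift_neg_shift m l, shift_shift_neg m l⟩

theorem D₁_eq (m : ℕ) (n : FourierIndex) :
    n.D₁ m = (n.r₁ : ℚ) ^ 2 - 4 * m * n.n₁₁ := by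
  simp [D₁, Matrix.det_fin_two]; ring

theorem D₂_eq (m : ℕ) (n : FourierIndex) :
    n.D₂ m = (n.r₂ : ℚ) ^ 2 - 4 * m * n.n₂₂ := by
  simp [D₂, Matrix.det_fin_two]; ring

theorem D_eq (m : ℕ) (n : FourierIndex) :
    n.D m = (n.r₁ : ℚ) * n.r₂ - 2 * m * n.n₁₂ := by
  simp [D, Matrix.det_fin_two]; ring

theorem ext_of_D {m : ℕ} (hm : 0 < m) {n n' : FourierIndex} (h1 : n.r₁ = n'.r₁)
    (h2 : n.r₂ = n'.r₂) (hD1 : n.D₁ m = n'.D₁ m) (hD2 : n.D₂ m = n'.D₂ m)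
    (hD : n.D m = n'.D m) : n = n' := by
  have hm' : (m : ℚ) ≠ 0 := by positivity
  rw [D₁_eq, D₁_eq, h1] at hD1
  rw [D₂_eq, D₂_eq, h2] at hD2
  rw [D_eq, D_eq, h1, h2] at hD
  have a1 : (n.n₁₁ : ℚ) = n'.n₁₁ := by
    apply mul_left_cancel₀ hm'; linarith
  have a2 : (n.n₂₂ : ℚ) = n'.n₂₂ := by
    apply mul_left_cancel₀ hm'; linarith
  have a3 : (n.n₁₂ : ℚ) = n'.n₁₂ := by
    apply mul_left_cancel₀ hm'; linarith
  ext
  · exact_mod_cast a1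
  · exact_mod_cast a3
  · exact_mod_cast a2
  · exact h1
  · exact h2

theorem D₁_shift (m : ℕ) (l : ℤ) (n : FourierIndex) : (shift m l n).D₁ m = n.D₁ m := by
  simp only [D₁_eq, shift]; push_cast; ring

theorem D₂_shift (m : ℕ) (l : ℤ) (n : FourierIndex) : (shift m l n).D₂ m = n.D₂ m := by
  simp only [D₂_eq, shift]

theorem D_shift (m : ℕ) (l : ℤ) (n : FourierIndex) : (shift m l n).D m = n.D m := by
  simp only [D_eq, shift]; push_cast; ring

theorem D₁_flip (m : ℕ) (n : FourierIndex) : n.flip.D₁ m = n.D₂ m := by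
  simp only [D₁_eq, D₂_eq, flip]

theorem D₂_flip (m : ℕ) (n : FourierIndex) : n.flip.D₂ m = n.D₁ m := by
  simp only [D₁_eq, D₂_eq, flip]

theorem D_flip (m : ℕ) (n : FourierIndex) : n.flip.D m = n.D m := by
  simp only [D_eq, flip]; ring

theorem r₁_shift (m : ℕ) (l : ℤ) (n : FourierIndex) :
    ((shift m l n).r₁ : ZMod (2 * m)) = n.r₁ := by
  have : ((2 * m : ℕ) : ZMod (2 * m)) = 0 := ZMod.natCast_self _
  simp only [shift]
  push_cast at this ⊢
  rw [this]; ring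

theorem exists_shift {m : ℕ} {n : FourierIndex} {r : ℤ} (h : (n.r₁ : ZMod (2 * m)) = r) :
    ∃ l, (shift m l n).r₁ = r := by
  have h1 := (ZMod.intCast_eq_intCast_iff_dvd_sub _ _ _).1 h
  obtain ⟨l, hl⟩ := h1
  refine ⟨l, ?_⟩
  simp only [shift]
  push_cast at hl
  linarith

/-- The indices as integral vectors. -/
def equivFun : FourierIndex ≃ (Fin 5 → ℤ) where
  toFun n := ![n.n₁₁, n.n₁₂, n.n₂₂, n.r₁, n.r₂]
  invFun v := ⟨v 0, v 1, v 2, v 3, v 4⟩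
  left_inv _ := rfl
  right_inv v := by ext i; fin_cases i <;> rfl

end FourierIndex

/-- Uniqueness of the Fourier coefficients. On the slice where `τ` and `w` have imaginary part `1`
and `z`, `x`, `y` are real, the expansion is an absolutely convergent Fourier series on the torus
`(ℝ/ℤ)⁵`. -/
theorem fourier_eq_zero {c : FourierIndex → ℂ}
    (h : ∀ τ z w x y, InH τ z w → HasSum (fun n => c n * e (n.phase τ z w x y)) 0)
    (n : FourierIndex) : c n = 0 := by
  let I := Complex.I
  have key : ∀ t : Fin 5 → ℝ, HasSum (fun v : Fin 5 → ℤ =>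
      (c (FourierIndex.equivFun.symm v) *
        e ((FourierIndex.equivFun.symm v).phase I 0 I 0 0)) *
        UnitAddTorus.mFourier v (fun i => (t i : UnitAddCircle))) 0 := by
    intro t
    have hH : InH (I + t 0) (t 1) (I + t 2) := ⟨by simp [I], by simp [I]⟩
    have h1 := (FourierIndex.equivFun.symm.hasSum_iff).2 (h _ _ _ (t 3) (t 4) hH)
    convert h1 using 2 with v
    simp only [Function.comp, mul_assoc]
    congr 1
    rw [UnitAddTorus.mFourier, ContinuousMap.coe_mk]
    simp only [fourier_coe_apply, ← Complex.exp_sum, e, ← Complex.exp_add]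
    congr 1
    have hv : FourierIndex.equivFun.symm v = ⟨v 0, v 1, v 2, v 3, v 4⟩ := rfl
    simp [Fin.sum_univ_five, FourierIndex.phase, hv]
    ring
  have hs := (key 0).summable.norm
  simp only [norm_mul, Pi.zero_apply] at hs
  have hs' : Summable fun v : Fin 5 → ℤ => ‖c (FourierIndex.equivFun.symm v) *
        e ((FourierIndex.equivFun.symm v).phase I 0 I 0 0)‖ := by
    convert hs using 2 with v
    simp [UnitAddTorus.mFourier]
  have := mFourier_coeff_eq_zero _ hs' key (FourierIndex.equivFun n)
  simpa [e_ne_zero] using this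

theorem fourier_unique {c c' : FourierIndex → ℂ} {f : CoordFun}
    (h : ∀ τ z w x y, InH τ z w → HasSum (fun n => c n * e (n.phase τ z w x y)) (f τ z w x y))
    (h' : ∀ τ z w x y, InH τ z w → HasSum (fun n => c' n * e (n.phase τ z w x y)) (f τ z w x y))
    (n : FourierIndex) : c n = c' n := by
  refine sub_eq_zero.1 (fourier_eq_zero (c := fun n => c n - c' n) ?_ n)
  intro τ z w x y hH
  simpa [sub_mul] using (h τ z w x y hH).sub (h' τ z w x y hH)

/-- The properties of a Jacobi form, written in coordinates, on which the comparison of the two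
Hecke operators depends: invariance under the two embedded degree one Jacobi groups, and a Fourier
expansion with integral exponents. -/
structure CoordJacobiForm (k m : ℕ) (φ : CoordFun) (C : FourierIndex → ℂ) : Prop where
  mat : ∀ g : Matrix.SpecialLinearGroup (Fin 2) ℤ, ∀ τ z w x y, InH τ z w →
    slashMat k m (toMatC g) φ τ z w x y = φ τ z w x y
  mat_flip : ∀ g : Matrix.SpecialLinearGroup (Fin 2) ℤ, ∀ τ z w x y, InH τ z w →
    slashMat k m (toMatC g) (flip φ) τ z w x y = flip φ τ z w x y
  heis : ∀ l : ℤ, ∀ τ z w x y, InH τ z w →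
    slashHeis m l 0 φ τ z w x y = φ τ z w x y
  heis_flip : ∀ l : ℤ, ∀ τ z w x y, InH τ z w →
    slashHeis m l 0 (flip φ) τ z w x y = flip φ τ z w x y
  hasSum : ∀ τ z w x y, InH τ z w → HasSum (fun n => C n * e (n.phase τ z w x y)) (φ τ z w x y)

@[simp]
theorem flip_flip (φ : CoordFun) : flip (flip φ) = φ := rfl

theorem isRealSL_toMatC_int (g : Matrix.SpecialLinearGroup (Fin 2) ℤ) : IsRealSL (toMatC g) := by
  refine ⟨fun i j => by simp [toMatC], ?_⟩
  have h := g.2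
  rw [Matrix.det_fin_two] at h
  simp only [toMatC, Matrix.map_apply, algebraMap_int_eq, eq_intCast]
  exact_mod_cast h

theorem isRealSL_toMatC_rat (g : Matrix.SpecialLinearGroup (Fin 2) ℚ) : IsRealSL (toMatC g) := by
  refine ⟨fun i j => by simp [toMatC], ?_⟩
  have h := g.2
  rw [Matrix.det_fin_two] at h
  simp only [toMatC, Matrix.map_apply, eq_ratCast]
  exact_mod_cast h

theorem IsRealSL.det {G : Matrix (Fin 2) (Fin 2) ℂ} (h : IsRealSL G) : G.det = 1 := by
  rw [Matrix.det_fin_two, h.det_eq_one]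

theorem slashHeis_zero (m : ℕ) (φ : CoordFun) : slashHeis m 0 0 φ = φ := by
  funext τ z w x y
  simp [slashHeis]

theorem slashMat_one (k m : ℕ) (φ : CoordFun) : slashMat k m 1 φ = φ := by
  funext τ z w x y
  simp [slashMat]

theorem IsJacobiForm.coord {k m : ℕ} {Φ : Matrix (Fin 2) (Fin 2) ℂ → (Fin 2 → ℂ) → ℂ}
    (hΦ : IsJacobiForm k m Φ) {C : FourierIndex → ℂ} (hC : HasFourierExpansion m Φ C) :
    CoordJacobiForm k m (toCoord Φ) C where
  mat g τ z w x y h := by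
    have hg := isRealSL_toMatC_int g
    have := hΦ.slash_eq (up g 0 0 0) _ ((mem_siegelUpperHalfSpace_iff τ z w).2 h) ![x, y]
    rw [slash_up_eq k m g 0 0 Φ _ _ _ _ _ (hg.denom_ne_zero h.im_pos) hg.det, map_zero,
      slashHeis_zero] at this
    exact this
  mat_flip g τ z w x y h := by
    have hg := isRealSL_toMatC_int g
    have := hΦ.slash_eq (down g 0 0 0) _ ((mem_siegelUpperHalfSpace_iff w z τ).2 h.symm) ![y, x]
    rw [slash_down_eq k m g 0 0 Φ _ _ _ _ _ (hg.denom_ne_zero h.im_pos) hg.det, map_zero,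
      slashHeis_zero] at this
    exact this
  heis l τ z w x y h := by
    have hg := isRealSL_toMatC_int 1
    have := hΦ.slash_eq (up 1 l 0 0) _ ((mem_siegelUpperHalfSpace_iff τ z w).2 h) ![x, y]
    rw [slash_up_eq k m 1 l 0 Φ _ _ _ _ _ (hg.denom_ne_zero h.im_pos) hg.det, map_zero] at this
    have h1 : toMatC (1 : Matrix.SpecialLinearGroup (Fin 2) ℤ) = 1 := by
      simp [toMatC]
    rw [h1, slashMat_one] at this
    exact this
  heis_flip l τ z w x y h := by
    have hg := isRealSL_toMatC_int 1
    have := hΦ.slash_eq (down 1 l 0 0) _ ((mem_siegelUpperHalfSpace_iff w z τ).2 h.symm) ![y, x]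
    rw [slash_down_eq k m 1 l 0 Φ _ _ _ _ _ (hg.denom_ne_zero h.im_pos) hg.det, map_zero] at this
    have h1 : toMatC (1 : Matrix.SpecialLinearGroup (Fin 2) ℤ) = 1 := by
      simp [toMatC]
    rw [h1, slashMat_one] at this
    exact this
  hasSum τ z w x y h := by
    have := hC.hasSum _ ((mem_siegelUpperHalfSpace_iff τ z w).2 h) ![x, y]
    simp only [FourierIndex.phase_eq] at this
    exact this

namespace CoordJacobiForm

variable {k m : ℕ} {φ : CoordFun} {C : FourierIndex → ℂ}

theorem flip (h : CoordJacobiForm k m φ C) :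
    CoordJacobiForm k m (flip φ) (C ∘ FourierIndex.flip) where
  mat := h.mat_flip
  mat_flip := h.mat
  heis := h.heis_flip
  heis_flip := h.heis
  hasSum τ z w x y hH := by
    have := (FourierIndex.flipEquiv.hasSum_iff).2 (h.hasSum w z τ y x hH.symm)
    refine this.congr_fun ?_
    intro n
    simp [FourierIndex.flipEquiv, FourierIndex.phase_flip]

theorem add_int (h : CoordJacobiForm k m φ C) {τ z w : ℂ} (x y : ℂ) (hH : InH τ z w)
    (a b c s t : ℤ) : φ (τ + a) (z + b) (w + c) (x + s) (y + t) = φ τ z w x y := by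
  refine (h.hasSum _ _ _ (x + s) (y + t) (hH.add_int a b c)).unique ?_
  convert h.hasSum τ z w x y hH using 2 with n
  have : n.phase (τ + a) (z + b) (w + c) (x + s) (y + t) = n.phase τ z w x y +
      ((n.n₁₁ * a + n.n₁₂ * b + n.n₂₂ * c + n.r₁ * s + n.r₂ * t : ℤ) : ℂ) := by
    simp only [FourierIndex.phase]
    push_cast
    ring
  rw [this, e_add_intCast]

/-- Invariance under the Heisenberg element `((l, 0), 0, 0)` permutes the terms of the Fourier
expansion. -/
theorem coeff_shift (h : CoordJacobiForm k m φ C) (l : ℤ) (n : FourierIndex) :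
    C (n.shift m l) = C n := by
  have key := fourier_unique (f := φ) (c := C)
    (c' := fun n => C ((FourierIndex.shiftEquiv m l).symm n)) h.hasSum ?_ (n.shift m l)
  · rw [key]
    exact congrArg C ((FourierIndex.shiftEquiv m l).symm_apply_apply n)
  · intro τ z w x y hH
    rw [← (FourierIndex.shiftEquiv m l).hasSum_iff]
    have h1 := (h.hasSum τ z w (x + l * τ + 0) (y + l * z) hH).mul_left
      (e (m * ((l : ℂ) ^ 2 * τ + 2 * l * x + 0 * l)))
    have h2 := h.heis l τ z w x y hH
    rw [slashHeis] at h2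
    rw [h2] at h1
    refine h1.congr_fun fun n => ?_
    simp only [Function.comp, Equiv.symm_apply_apply]
    rw [mul_left_comm, ← e_add]
    congr 2
    simp only [FourierIndex.shiftEquiv, Equiv.coe_fn_mk, FourierIndex.shift, FourierIndex.phase]
    push_cast
    ring

/-- The Fourier coefficients depend only on the invariants: two indices with the same invariants
differ by a shift in each of the two variables. -/
theorem coeff_congr (hm : 0 < m) (h : CoordJacobiForm k m φ C) {n n' : FourierIndex}
    (h1 : (n.r₁ : ZMod (2 * m)) = n'.r₁) (h2 : (n.r₂ : ZMod (2 * m)) = n'.r₂)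
    (hD1 : n.D₁ m = n'.D₁ m) (hD2 : n.D₂ m = n'.D₂ m) (hD : n.D m = n'.D m) : C n = C n' := by
  obtain ⟨l, hl⟩ := FourierIndex.exists_shift h1
  have h2' : ((n.shift m l).flip.r₁ : ZMod (2 * m)) = n'.r₂ := h2
  obtain ⟨l', hl'⟩ := FourierIndex.exists_shift h2'
  have e1 : (((n.shift m l).flip).shift m l').flip = n' := by
    refine FourierIndex.ext_of_D hm ?_ ?_ ?_ ?_ ?_
    · exact hl
    · exact hl'
    · simp only [FourierIndex.D₁_flip, FourierIndex.D₂_flip, FourierIndex.D₁_shift,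
        FourierIndex.D₂_shift, hD1]
    · simp only [FourierIndex.D₁_flip, FourierIndex.D₂_flip, FourierIndex.D₁_shift,
        FourierIndex.D₂_shift, hD2]
    · simp only [FourierIndex.D_flip, FourierIndex.D_shift, hD]
  have e2 := h.flip.coeff_shift l' (n.shift m l).flip
  simp only [Function.comp, e1, FourierIndex.flip_flip] at e2
  rw [e2, h.coeff_shift]

theorem coeff_eq (hm : 0 < m) (h : CoordJacobiForm k m φ C) {n : FourierIndex}
    {r₁ r₂ : ZMod (2 * m)} {D₁ D₂ D : ℚ} (h1 : (n.r₁ : ZMod (2 * m)) = r₁)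
    (h2 : (n.r₂ : ZMod (2 * m)) = r₂) (hD1 : n.D₁ m = D₁) (hD2 : n.D₂ m = D₂)
    (hD : n.D m = D) : coeff m C r₁ r₂ D₁ D₂ D = C n := by
  have hex : ∃ x : FourierIndex, (x.r₁ : ZMod (2 * m)) = r₁ ∧ (x.r₂ : ZMod (2 * m)) = r₂ ∧
      x.D₁ m = D₁ ∧ x.D₂ m = D₂ ∧ x.D m = D := ⟨n, h1, h2, hD1, hD2, hD⟩
  rw [coeff, dif_pos hex]
  obtain ⟨a1, a2, a3, a4, a5⟩ := hex.choose_spec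
  exact h.coeff_congr hm (a1.trans h1.symm) (a2.trans h2.symm) (a3.trans hD1.symm)
    (a4.trans hD2.symm) (a5.trans hD.symm)

end CoordJacobiForm

theorem coeff_eq_zero {m : ℕ} {C : FourierIndex → ℂ} {r₁ r₂ : ZMod (2 * m)} {D₁ D₂ D : ℚ}
    (h : ∀ n : FourierIndex, (n.r₁ : ZMod (2 * m)) = r₁ → (n.r₂ : ZMod (2 * m)) = r₂ →
      n.D₁ m = D₁ → n.D₂ m = D₂ → n.D m = D → False) : coeff m C r₁ r₂ D₁ D₂ D = 0 := by
  rw [coeff, dif_neg]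
  rintro ⟨n, h1, h2, h3, h4, h5⟩
  exact h n h1 h2 h3 h4 h5

theorem CoordJacobiForm.coeff_flip {k m : ℕ} {φ : CoordFun} {C : FourierIndex → ℂ} (hm : 0 < m)
    (h : CoordJacobiForm k m φ C) (r₁ r₂ : ZMod (2 * m)) (D₁ D₂ D : ℚ) :
    coeff m (C ∘ FourierIndex.flip) r₂ r₁ D₂ D₁ D = coeff m C r₁ r₂ D₁ D₂ D := by
  by_cases hex : ∃ n : FourierIndex, (n.r₁ : ZMod (2 * m)) = r₁ ∧ (n.r₂ : ZMod (2 * m)) = r₂ ∧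
      n.D₁ m = D₁ ∧ n.D₂ m = D₂ ∧ n.D m = D
  · obtain ⟨n, h1, h2, h3, h4, h5⟩ := hex
    rw [h.coeff_eq hm h1 h2 h3 h4 h5, h.flip.coeff_eq hm (n := n.flip) h2 h1
      ((n.D₁_flip m).trans h4) ((n.D₂_flip m).trans h3) ((n.D_flip m).trans h5)]
    rfl
  · rw [coeff_eq_zero (fun n h1 h2 h3 h4 h5 => hex ⟨n, h1, h2, h3, h4, h5⟩)]
    refine coeff_eq_zero (fun n h1 h2 h3 h4 h5 => hex ⟨n.flip, h2, h1, ?_, ?_, ?_⟩)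
    · rw [n.D₁_flip, h4]
    · rw [n.D₂_flip, h3]
    · rw [n.D_flip, h5]

/-! ### The Hecke operator in coordinates -/

/-- The operator `T^J(ℓ)^↑` in coordinates. -/
def heckeSum (k m ℓ : ℕ) [NeZero ℓ] (φ : CoordFun) : CoordFun := fun τ z w x y =>
  (ℓ : ℂ) ^ ((k : ℤ) - 4) *
    ∑ᶠ (q : HeckeCosets ℓ) (_ : IsSquare (entriesGcd q.out.1)),
      ∑ l ∈ Finset.range ℓ, ∑ u ∈ Finset.range ℓ,
        slashHeis m l u (slashMat k m (toMatC (scaled ℓ q.out)) φ) τ z w x y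

theorem heckeUp_eq (k m ℓ : ℕ) [NeZero ℓ] (Φ : Matrix (Fin 2) (Fin 2) ℂ → (Fin 2 → ℂ) → ℂ)
    {τ z w : ℂ} (h : InH τ z w) (x y : ℂ) :
    heckeUp k m ℓ Φ !![τ, z; z, w] ![x, y] = heckeSum k m ℓ (toCoord Φ) τ z w x y := by
  rw [heckeUp, heckeOperator, heckeSum]
  congr 1
  refine finsum_congr fun q => finsum_congr fun _ => Finset.sum_congr rfl fun l _ =>
    Finset.sum_congr rfl fun u _ => ?_
  have hg := isRealSL_toMatC_rat (scaled ℓ q.out)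
  rw [slash_up_eq k m _ _ _ Φ _ _ _ _ _ (hg.denom_ne_zero h.im_pos) hg.det]
  simp

theorem heckeDown_eq (k m ℓ : ℕ) [NeZero ℓ] (Φ : Matrix (Fin 2) (Fin 2) ℂ → (Fin 2 → ℂ) → ℂ)
    {τ z w : ℂ} (h : InH τ z w) (x y : ℂ) :
    heckeDown k m ℓ Φ !![τ, z; z, w] ![x, y] =
      flip (heckeSum k m ℓ (flip (toCoord Φ))) τ z w x y := by
  rw [heckeDown, heckeOperator, flip, heckeSum]
  congr 1
  refine finsum_congr fun q => finsum_congr fun _ => Finset.sum_congr rfl fun l _ =>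
    Finset.sum_congr rfl fun u _ => ?_
  have hg := isRealSL_toMatC_rat (scaled ℓ q.out)
  rw [slash_down_eq k m _ _ _ Φ _ _ _ _ _ (hg.denom_ne_zero h.symm.im_pos) hg.det]
  simp

/-! ### Sums over the cosets -/

theorem dvd_entriesGcd_iff (n : ℕ) (M : Matrix (Fin 2) (Fin 2) ℤ) :
    n ∣ entriesGcd M ↔ ∀ i j, (n : ℤ) ∣ M i j := by
  simp only [entriesGcd, Nat.dvd_gcd_iff, Int.dvd_gcd_iff, Fin.forall_fin_two]

theorem entriesGcd_dvd_mul_left (g M : Matrix (Fin 2) (Fin 2) ℤ) :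
    entriesGcd M ∣ entriesGcd (g * M) := by
  rw [dvd_entriesGcd_iff]
  have h := (dvd_entriesGcd_iff _ M).1 dvd_rfl
  intro i j
  rw [Matrix.mul_apply]
  exact Finset.dvd_sum fun s _ => Dvd.dvd.mul_left (h s j) _

theorem entriesGcd_dvd_mul_right (g M : Matrix (Fin 2) (Fin 2) ℤ) :
    entriesGcd M ∣ entriesGcd (M * g) := by
  rw [dvd_entriesGcd_iff]
  have h := (dvd_entriesGcd_iff _ M).1 dvd_rfl
  intro i j
  rw [Matrix.mul_apply]
  exact Finset.dvd_sum fun s _ => Dvd.dvd.mul_right (h i s) _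

theorem entriesGcd_mul_left (g : Matrix.SpecialLinearGroup (Fin 2) ℤ)
    (M : Matrix (Fin 2) (Fin 2) ℤ) : entriesGcd (g.1 * M) = entriesGcd M := by
  refine Nat.dvd_antisymm ?_ (entriesGcd_dvd_mul_left _ _)
  have h := entriesGcd_dvd_mul_left (g⁻¹).1 (g.1 * M)
  have h2 : (g⁻¹).1 * (g.1 * M) = M := by
    have h1 : (g⁻¹).1 * g.1 = 1 := congrArg Subtype.val (inv_mul_cancel g)
    rw [← mul_assoc, h1, one_mul]
  rwa [h2] at h

theorem entriesGcd_mul_right (g : Matrix.SpecialLinearGroup (Fin 2) ℤ)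
    (M : Matrix (Fin 2) (Fin 2) ℤ) : entriesGcd (M * g.1) = entriesGcd M := by
  refine Nat.dvd_antisymm ?_ (entriesGcd_dvd_mul_right _ _)
  have h := entriesGcd_dvd_mul_right (g⁻¹).1 (M * g.1)
  have h2 : M * g.1 * (g⁻¹).1 = M := by
    have h1 : g.1 * (g⁻¹).1 = 1 := congrArg Subtype.val (mul_inv_cancel g)
    rw [mul_assoc, h1, mul_one]
  rwa [h2] at h

/-- Right multiplication by `SL₂(ℤ)` on integral matrices of fixed determinant. -/
def mulRight {N : ℤ} (g : Matrix.SpecialLinearGroup (Fin 2) ℤ) (M : FixedDetMatrix (Fin 2) ℤ N) :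
    FixedDetMatrix (Fin 2) ℤ N :=
  ⟨M.1 * g.1, by rw [Matrix.det_mul, M.2, g.2, mul_one]⟩

section Cosets

variable {ℓ : ℕ}

theorem mk_eq_mk_iff (A B : FixedDetMatrix (Fin 2) ℤ ((ℓ : ℤ) ^ 2)) :
    (Quotient.mk'' A : HeckeCosets ℓ) = Quotient.mk'' B ↔
      ∃ γ : Matrix.SpecialLinearGroup (Fin 2) ℤ, γ • B = A := by
  rw [Quotient.eq'', MulAction.orbitRel_apply, MulAction.mem_orbit_iff]

theorem exists_smul_eq_out (A : FixedDetMatrix (Fin 2) ℤ ((ℓ : ℤ) ^ 2)) :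
    ∃ γ : Matrix.SpecialLinearGroup (Fin 2) ℤ,
      γ • A = (Quotient.mk'' A : HeckeCosets ℓ).out :=
  (mk_eq_mk_iff _ _).1 (Quotient.out_eq' (Quotient.mk'' A : HeckeCosets ℓ))

/-- Right multiplication by `SL₂(ℤ)` on the cosets. -/
def cosetMul (g : Matrix.SpecialLinearGroup (Fin 2) ℤ) : HeckeCosets ℓ → HeckeCosets ℓ :=
  Quotient.map' (mulRight g) (by
    rintro A B ⟨γ, rfl⟩
    refine ⟨γ, ?_⟩
    apply FixedDetMatrices.ext'
    change γ.1 * (B.1 * g.1) = γ.1 * B.1 * g.1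
    rw [mul_assoc])

theorem cosetMul_mk (g : Matrix.SpecialLinearGroup (Fin 2) ℤ)
    (A : FixedDetMatrix (Fin 2) ℤ ((ℓ : ℤ) ^ 2)) :
    cosetMul g (Quotient.mk'' A : HeckeCosets ℓ) = Quotient.mk'' (mulRight g A) := rfl

theorem cosetMul_bijective (g : Matrix.SpecialLinearGroup (Fin 2) ℤ) :
    Function.Bijective (cosetMul (ℓ := ℓ) g) := by
  have key : ∀ g : Matrix.SpecialLinearGroup (Fin 2) ℤ, ∀ q : HeckeCosets ℓ,
      cosetMul g⁻¹ (cosetMul g q) = q := by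
    intro g q
    induction q using Quotient.inductionOn' with
    | h A =>
      rw [cosetMul_mk, cosetMul_mk]
      congr 1
      apply FixedDetMatrices.ext'
      have h1 : g.1 * (g⁻¹).1 = 1 := congrArg Subtype.val (mul_inv_cancel g)
      simp only [mulRight, mul_assoc, h1, mul_one]
  refine Function.bijective_iff_has_inverse.2 ⟨cosetMul g⁻¹, key g, fun q => ?_⟩
  simpa using key g⁻¹ q

/-- Right multiplication by `SL₂(ℤ)` permutes the cosets and preserves the gcd of the entries. -/
theorem finsum_cosets_mulRight (F : FixedDetMatrix (Fin 2) ℤ ((ℓ : ℤ) ^ 2) → ℂ)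
    (hF : ∀ (γ : Matrix.SpecialLinearGroup (Fin 2) ℤ) M, F (γ • M) = F M)
    (g : Matrix.SpecialLinearGroup (Fin 2) ℤ) :
    ∑ᶠ (q : HeckeCosets ℓ) (_ : IsSquare (entriesGcd q.out.1)), F (mulRight g q.out) =
      ∑ᶠ (q : HeckeCosets ℓ) (_ : IsSquare (entriesGcd q.out.1)), F q.out := by
  refine finsum_eq_of_bijective _ (cosetMul_bijective g) fun q => ?_
  have hq : cosetMul g q = Quotient.mk'' (mulRight g q.out) := by
    rw [← cosetMul_mk, Quotient.out_eq']
  obtain ⟨γ, hγ⟩ := exists_smul_eq_out (mulRight g q.out)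
  rw [hq, ← hγ, hF, FixedDetMatrices.smul_coe, entriesGcd_mul_left, mulRight, entriesGcd_mul_right]

theorem exists_reps (hℓ : ℓ ≠ 0) (q : HeckeCosets ℓ) :
    ∃ B ∈ FixedDetMatrices.reps ((ℓ : ℤ) ^ 2), (Quotient.mk'' B : HeckeCosets ℓ) = q := by
  have hl : ((ℓ : ℤ) ^ 2) ≠ 0 := pow_ne_zero _ (by exact_mod_cast hℓ)
  have key : ∀ A : FixedDetMatrix (Fin 2) ℤ ((ℓ : ℤ) ^ 2),
      ∃ B ∈ FixedDetMatrices.reps ((ℓ : ℤ) ^ 2),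
        (Quotient.mk'' B : HeckeCosets ℓ) = Quotient.mk'' A := by
    intro A
    induction A using FixedDetMatrices.induction_on hl with
    | h0 A h1 h2 h3 h4 => exact ⟨A, ⟨h1, h2, h3, h4⟩, rfl⟩
    | hS B hB =>
      obtain ⟨D, hD, h⟩ := hB
      exact ⟨D, hD, h.trans ((mk_eq_mk_iff _ _).2 ⟨_, rfl⟩).symm⟩
    | hT B hB =>
      obtain ⟨D, hD, h⟩ := hB
      exact ⟨D, hD, h.trans ((mk_eq_mk_iff _ _).2 ⟨_, rfl⟩).symm⟩
  induction q using Quotient.inductionOn' with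
  | h A => exact key A

theorem reps_spec {A : FixedDetMatrix (Fin 2) ℤ ((ℓ : ℤ) ^ 2)}
    (hA : A ∈ FixedDetMatrices.reps ((ℓ : ℤ) ^ 2)) :
    A.1 1 0 = 0 ∧ A.1 0 0 * A.1 1 1 = (ℓ : ℤ) ^ 2 ∧ 0 < A.1 0 0 ∧ 0 ≤ A.1 0 1 ∧
      A.1 0 1 < A.1 1 1 := by
  obtain ⟨h1, h2, h3, h4⟩ := hA
  have h5 := A.2
  rw [Matrix.det_fin_two, h1, mul_zero, sub_zero] at h5
  have h6 : 0 ≤ A.1 1 1 := by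
    by_contra! h
    have := mul_neg_of_pos_of_neg h2 h
    rw [h5] at this
    exact absurd this (not_lt.2 (sq_nonneg _))
  rw [abs_of_nonneg h3, abs_of_nonneg h6] at h4
  exact ⟨h1, h5, h2, h3, h4⟩

theorem reps_injOn {A B : FixedDetMatrix (Fin 2) ℤ ((ℓ : ℤ) ^ 2)}
    (hA : A ∈ FixedDetMatrices.reps ((ℓ : ℤ) ^ 2)) (hB : B ∈ FixedDetMatrices.reps ((ℓ : ℤ) ^ 2))
    (h : (Quotient.mk'' A : HeckeCosets ℓ) = Quotient.mk'' B) : A = B := by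
  obtain ⟨a1, a2, a3, a4, a5⟩ := reps_spec hA
  obtain ⟨b1, b2, b3, b4, b5⟩ := reps_spec hB
  obtain ⟨γ, hγ⟩ := (mk_eq_mk_iff _ _).1 h
  have e : ∀ i j, γ.1 i 0 * B.1 0 j + γ.1 i 1 * B.1 1 j = A.1 i j := by
    intro i j
    rw [← hγ, FixedDetMatrices.smul_coe, Matrix.mul_apply, Fin.sum_univ_two]
  have hdet := γ.2
  rw [Matrix.det_fin_two] at hdet
  have e00 := e 0 0
  have e01 := e 0 1
  have e10 := e 1 0
  have e11 := e 1 1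
  rw [b1, mul_zero, add_zero] at e00 e10
  rw [a1, mul_eq_zero, or_iff_left b3.ne'] at e10
  rw [e10, zero_mul, zero_add] at e11
  rw [e10, mul_zero, sub_zero] at hdet
  -- The left factor is unipotent, and the entry above the diagonal is reduced.
  have g00 : γ.1 0 0 = 1 := by
    rcases Int.eq_one_or_neg_one_of_mul_eq_one hdet with h | h
    · exact h
    · rw [h] at e00; linarith
  rw [g00, one_mul] at hdet e00 e01
  rw [hdet, one_mul] at e11
  have g01 : γ.1 0 1 = 0 := by
    rw [← e11] at a5
    rw [← e01] at a4 a5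
    have h1 : γ.1 0 1 < 1 := by
      by_contra! h
      nlinarith
    have h2 : -1 < γ.1 0 1 := by
      by_contra! h
      nlinarith
    omega
  rw [g01, zero_mul, add_zero] at e01
  apply FixedDetMatrices.ext
  intro i j
  fin_cases i <;> fin_cases j
  · exact e00.symm
  · exact e01.symm
  · exact a1.trans b1.symm
  · exact e11.symm

end Cosets

/-- A matrix of determinant `p²` whose gcd is a square is primitive, because the gcd divides the
prime `p`. The cosets of such matrices are represented by the primitive matrices `(a, b; 0, d)` with
`a d = p²` and `0 ≤ b < d`. -/
theorem finsum_cosets_eq (p : ℕ) [hp : Fact p.Prime]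
    (F : FixedDetMatrix (Fin 2) ℤ ((p : ℤ) ^ 2) → ℂ)
    (hF : ∀ (γ : Matrix.SpecialLinearGroup (Fin 2) ℤ) M, F (γ • M) = F M)
    (g : ℤ → ℤ → ℤ → ℂ)
    (hg : ∀ M, M.1 1 0 = 0 → F M = g (M.1 0 0) (M.1 0 1) (M.1 1 1)) :
    ∑ᶠ (q : HeckeCosets p) (_ : IsSquare (entriesGcd q.out.1)), F q.out =
      g (p ^ 2) 0 1 + ∑ b ∈ Finset.Ico 1 p, g p b p +
        ∑ b ∈ Finset.range (p ^ 2), g 1 b (p ^ 2) := by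
  classical
  have hp0 : 0 < p := hp.out.pos
  have hp1 : 1 < p := hp.out.one_lt
  have hpz : (0 : ℤ) < p := by exact_mod_cast hp0
  set S : Set (FixedDetMatrix (Fin 2) ℤ ((p : ℤ) ^ 2)) :=
    {M | M ∈ FixedDetMatrices.reps ((p : ℤ) ^ 2) ∧ IsSquare (entriesGcd M.1)} with hS
  have step1 : ∑ᶠ M ∈ S, F M =
      ∑ᶠ q ∈ {q : HeckeCosets p | IsSquare (entriesGcd q.out.1)}, F q.out := by
    refine finsum_mem_eq_of_bijOn (fun M => (Quotient.mk'' M : HeckeCosets p)) ⟨?_, ?_, ?_⟩ ?_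
    · intro M hM
      obtain ⟨γ, hγ⟩ := exists_smul_eq_out M
      rw [Set.mem_ofPred_eq, ← hγ, FixedDetMatrices.smul_coe, entriesGcd_mul_left]
      exact hM.2
    · intro A hA B hB h
      exact reps_injOn hA.1 hB.1 h
    · intro q hq
      obtain ⟨B, hB, rfl⟩ := exists_reps hp0.ne' q
      refine ⟨B, ⟨hB, ?_⟩, rfl⟩
      obtain ⟨γ, hγ⟩ := exists_smul_eq_out B
      rwa [Set.mem_ofPred_eq, ← hγ, FixedDetMatrices.smul_coe, entriesGcd_mul_left] at hq
    · intro M _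
      obtain ⟨γ, hγ⟩ := exists_smul_eq_out M
      rw [← hγ, hF]
  -- The pairs `(d, b)` of the primitive representatives; `a = p² / d` is determined by `d`.
  set J : Finset (ℕ × ℕ) :=
    ({(1, 0)} ∪ ({p} ×ˢ Finset.Ico 1 p)) ∪ ({p ^ 2} ×ˢ Finset.range (p ^ 2)) with hJ
  let G : ℕ × ℕ → ℂ := fun t => g ((p ^ 2 / t.1 : ℕ) : ℤ) t.2 t.1
  have hd1 : p ^ 2 / p = p := by rw [sq, Nat.mul_div_cancel _ hp0]
  have hd2 : p ^ 2 / p ^ 2 = 1 := Nat.div_self (by positivity)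
  have gcd_tri : ∀ a b d : ℤ, entriesGcd !![a, b; 0, d] = Nat.gcd (Int.gcd a b) d.natAbs := by
    intro a b d
    simp [entriesGcd]
  have not_sq : ¬ IsSquare p := fun h => hp.out.prime.not_isSquare h
  have step2 : ∑ᶠ M ∈ S, F M = ∑ᶠ t ∈ (J : Set (ℕ × ℕ)), G t := by
    refine finsum_mem_eq_of_bijOn (fun M => ((M.1 1 1).toNat, (M.1 0 1).toNat)) ⟨?_, ?_, ?_⟩ ?_
    · intro M hM
      obtain ⟨h1, h2, h3, h4, h5⟩ := reps_spec hM.1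
      have hM2 := hM.2
      rw [Matrix.eta_fin_two M.1, h1, gcd_tri] at hM2
      change ((M.1 1 1).toNat, (M.1 0 1).toNat) ∈ (J : Set (ℕ × ℕ))
      generalize M.1 0 0 = a at *
      generalize M.1 0 1 = b at *
      generalize M.1 1 1 = d at *
      lift a to ℕ using h3.le
      lift b to ℕ using h4
      lift d to ℕ using by omega
      have h6 : a * d = p ^ 2 := by exact_mod_cast h2
      have h7 : b < d := by exact_mod_cast h5
      obtain ⟨i, hi, hd⟩ := (Nat.dvd_prime_pow hp.out).1 (Dvd.intro_left a h6)
      simp only [hJ, Int.toNat_natCast, Finset.coe_union, Set.mem_union, Finset.mem_coe,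
        Finset.mem_singleton, Finset.mem_product, Prod.mk.injEq, Finset.mem_Ico, Finset.mem_range]
      interval_cases i
      · rw [pow_zero] at hd
        left; left; constructor <;> omega
      · left; right
        rw [pow_one] at hd
        refine ⟨hd, ?_, by omega⟩
        by_contra! hb
        have ha : a = p := by
          rw [hd, sq] at h6
          exact mul_right_cancel₀ hp0.ne' h6
        apply not_sq
        have hb0 : b = 0 := by omega
        simpa [hb0, ha, hd] using hM2
      · right
        exact ⟨hd, by omega⟩
    · intro A hA B hB h
      obtain ⟨a1, a2, a3, a4, a5⟩ := reps_spec hA.1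
      obtain ⟨b1, b2, b3, b4, b5⟩ := reps_spec hB.1
      simp only [Prod.mk.injEq] at h
      have e1 : A.1 1 1 = B.1 1 1 := by omega
      have e2 : A.1 0 1 = B.1 0 1 := by omega
      have e3 : A.1 0 0 = B.1 0 0 := by
        have h3 := a2.trans b2.symm
        rw [e1] at h3
        exact mul_right_cancel₀ (by omega) h3
      apply FixedDetMatrices.ext
      intro i j
      fin_cases i <;> fin_cases j
      · exact e3
      · exact e2
      · exact a1.trans b1.symm
      · exact e1
    · have surj : ∀ a b d : ℕ, a * d = p ^ 2 → b < d → Nat.gcd (Nat.gcd a b) d = 1 →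
          (d, b) ∈ (fun M : FixedDetMatrix (Fin 2) ℤ ((p : ℤ) ^ 2) =>
            ((M.1 1 1).toNat, (M.1 0 1).toNat)) '' S := by
        intro a b d had hbd hgcd
        have had' : (a : ℤ) * d = (p : ℤ) ^ 2 := by exact_mod_cast had
        have ha : 0 < a := by
          rcases Nat.eq_zero_or_pos a with h | h
          · rw [h, zero_mul] at had
            have : 0 < p ^ 2 := by positivity
            omega
          · exact h
        refine ⟨⟨!![(a : ℤ), b; 0, d], by rw [Matrix.det_fin_two_of, mul_zero, sub_zero, had']⟩,
          ⟨⟨rfl, ?_, ?_, ?_⟩, ?_⟩, ?_⟩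
        · change (0 : ℤ) < a
          exact_mod_cast ha
        · change (0 : ℤ) ≤ b
          omega
        · change |(b : ℤ)| < |(d : ℤ)|
          rw [Nat.abs_cast, Nat.abs_cast]
          exact_mod_cast hbd
        · change IsSquare (entriesGcd !![(a : ℤ), b; 0, d])
          rw [gcd_tri, Int.gcd_natCast_natCast, Int.natAbs_natCast, hgcd]
          exact IsSquare.one
        · change ((d : ℤ).toNat, (b : ℤ).toNat) = (d, b)
          simp
      rintro ⟨d, b⟩ ht
      simp only [hJ, Finset.coe_union, Set.mem_union, Finset.mem_coe,
        Finset.mem_singleton, Finset.mem_product, Prod.mk.injEq, Finset.mem_Ico,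
        Finset.mem_range] at ht
      rcases ht with (⟨rfl, rfl⟩ | ⟨rfl, h1, h2⟩) | ⟨rfl, h1⟩
      · exact surj (p ^ 2) 0 1 (by ring) one_pos (Nat.gcd_one_right _)
      · refine surj d b d (by ring) h2 ?_
        rw [(hp.out.coprime_iff_not_dvd.2 fun h => absurd (Nat.le_of_dvd h1 h) (not_le.2 h2) :
          Nat.gcd d b = 1), Nat.gcd_one_left]
      · exact surj 1 b (p ^ 2) (by ring) h1 (by simp)
    · intro M hM
      obtain ⟨h1, h2, h3, h4, h5⟩ := reps_spec hM.1
      rw [hg M h1]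
      have e1 : ((M.1 1 1).toNat : ℤ) = M.1 1 1 := Int.toNat_of_nonneg (by omega)
      have e2 : ((M.1 0 1).toNat : ℤ) = M.1 0 1 := Int.toNat_of_nonneg h4
      simp only [G]
      push_cast
      rw [e1, e2, Int.ediv_eq_of_eq_mul_left (by omega) h2.symm]
  have hdisj1 : Disjoint ({(1, 0)} : Finset (ℕ × ℕ)) ({p} ×ˢ Finset.Ico 1 p) := by
    rw [Finset.disjoint_singleton_left]
    simp
  have hdisj2 : Disjoint (({(1, 0)} : Finset (ℕ × ℕ)) ∪ ({p} ×ˢ Finset.Ico 1 p))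
      ({p ^ 2} ×ˢ Finset.range (p ^ 2)) := by
    rw [Finset.disjoint_left]
    rintro ⟨a, b⟩ h1 h2
    simp only [Finset.mem_union, Finset.mem_singleton, Prod.mk.injEq, Finset.mem_product] at h1 h2
    have : p < p ^ 2 := by nlinarith
    rcases h1 with h1 | h1 <;> omega
  have step3 : ∑ t ∈ J, G t = g (p ^ 2) 0 1 + ∑ b ∈ Finset.Ico 1 p, g p b p +
      ∑ b ∈ Finset.range (p ^ 2), g 1 b (p ^ 2) := by
    rw [hJ, Finset.sum_union hdisj2, Finset.sum_union hdisj1, Finset.sum_singleton,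
      Finset.sum_product, Finset.sum_singleton, Finset.sum_product, Finset.sum_singleton]
    simp only [G, hd1, hd2]
    simp
  rw [← step3, ← finsum_mem_coe_finset, ← step2, step1]
  rfl

/-! ### Invariance properties of the Hecke operators -/

/-- The affine substitution `u ↦ a u + c` permutes the residues modulo `p`. -/
theorem sum_range_affine {p : ℕ} (hp : 0 < p) {h : ℤ → ℂ} (hper : ∀ u, h (u + p) = h u)
    {a : ℤ} (ha : IsCoprime a p) (c : ℤ) :
    ∑ u ∈ Finset.range p, h (a * u + c) = ∑ u ∈ Finset.range p, h u := by
  have hpz : (0 : ℤ) < p := by exact_mod_cast hp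
  have hmod : ∀ u, h (u % p) = h u := by
    intro u
    have h1 := (show Function.Periodic h (p : ℤ) from hper).sub_zsmul_eq (x := u) (u / p)
    rw [← h1]
    congr 1
    rw [Int.emod_def, smul_eq_mul, mul_comm]
  have hcast : ∀ u : ℤ, (((u % p).toNat : ℕ) : ℤ) = u % p := fun u =>
    Int.toNat_of_nonneg (Int.emod_nonneg _ hpz.ne')
  have hmaps : Set.MapsTo (fun u : ℕ => ((a * u + c) % p).toNat) (Finset.range p : Set ℕ)
      (Finset.range p : Set ℕ) := by
    intro u _
    have := Int.emod_lt_of_pos (a * u + c) hpz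
    simp only [Finset.coe_range, Set.mem_Iio]
    have := hcast (a * u + c)
    omega
  have hinj : Set.InjOn (fun u : ℕ => ((a * u + c) % p).toNat) (Finset.range p : Set ℕ) := by
    intro u hu v hv huv
    simp only [Finset.coe_range, Set.mem_Iio] at hu hv
    have h1 : (a * u + c) % p = (a * v + c) % p := by
      rw [← hcast, ← hcast (a * v + c)]
      exact congrArg Nat.cast huv
    have h2 : (p : ℤ) ∣ a * ((u : ℤ) - v) := by
      have h3 := Int.ModEq.dvd (show (a * v + c) ≡ (a * u + c) [ZMOD p] from h1.symm)
      convert h3 using 1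
      ring
    have h3 : (p : ℤ) ∣ (u : ℤ) - v := ha.symm.dvd_of_dvd_mul_left h2
    have h4 := Int.eq_zero_of_abs_lt_dvd h3 (by rw [abs_lt]; constructor <;> omega)
    omega
  refine Finset.sum_nbij (fun u : ℕ => ((a * u + c) % p).toNat) (fun u hu => hmaps hu) hinj
    (Finset.surjOn_of_injOn_of_card_le _ hmaps hinj le_rfl) fun u _ => ?_
  rw [hcast, hmod]

theorem CoordJacobiForm.slashHeis_int {k m : ℕ} {φ : CoordFun} {C : FourierIndex → ℂ}
    (h : CoordJacobiForm k m φ C) (l u : ℤ) {τ z w : ℂ} (hH : InH τ z w) (x y : ℂ) :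
    slashHeis m l u φ τ z w x y = φ τ z w x y := by
  have h1 := h.add_int (x + l * τ) (y + l * z) hH 0 0 0 u 0
  have h2 := h.heis l τ z w x y hH
  simp only [slashHeis, Int.cast_zero, add_zero] at h1 h2 ⊢
  rw [h1, ← h2]
  have h3 : (m * ((l : ℂ) ^ 2 * τ + 2 * l * x + u * l)) =
      m * ((l : ℂ) ^ 2 * τ + 2 * l * x + 0 * l) + ((m * u * l : ℤ) : ℂ) := by
    push_cast; ring
  rw [h3, e_add_intCast]

theorem slashHeis_periodic {m ℓ : ℕ} {ψ : CoordFun} {τ z w : ℂ}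
    (hψ : ∀ x y, ψ τ z w (x + ℓ) y = ψ τ z w x y) (l u : ℤ) (x y : ℂ) :
    slashHeis m l ((u + ℓ : ℤ) : ℂ) ψ τ z w x y = slashHeis m l u ψ τ z w x y := by
  simp only [slashHeis]
  have h1 : x + l * τ + ((u + ℓ : ℤ) : ℂ) = x + l * τ + u + ℓ := by push_cast; ring
  have h2 : (m * ((l : ℂ) ^ 2 * τ + 2 * l * x + ((u + ℓ : ℤ) : ℂ) * l)) =
      m * ((l : ℂ) ^ 2 * τ + 2 * l * x + u * l) + ((m * ℓ * l : ℤ) : ℂ) := by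
    push_cast; ring
  rw [h1, hψ, h2, e_add_intCast]

section Scaled

variable {ℓ : ℕ} [NeZero ℓ]

theorem toMatC_scaled_apply (M : FixedDetMatrix (Fin 2) ℤ ((ℓ : ℤ) ^ 2)) (i j : Fin 2) :
    toMatC (scaled ℓ M) i j = M.1 i j / ℓ := by
  simp only [toMatC, scaled, Matrix.map_apply, Matrix.smul_apply, smul_eq_mul, eq_ratCast]
  push_cast
  ring

theorem toMatC_scaled_smul (γ : Matrix.SpecialLinearGroup (Fin 2) ℤ)
    (M : FixedDetMatrix (Fin 2) ℤ ((ℓ : ℤ) ^ 2)) :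
    toMatC (scaled ℓ (γ • M)) = toMatC γ * toMatC (scaled ℓ M) := by
  ext i j
  rw [toMatC_scaled_apply, FixedDetMatrices.smul_coe, Matrix.mul_apply, Matrix.mul_apply]
  simp only [Fin.sum_univ_two, toMatC_scaled_apply]
  simp only [toMatC, Matrix.map_apply, algebraMap_int_eq, eq_intCast]
  push_cast
  ring

theorem mulRight_val {N : ℤ} (g : Matrix.SpecialLinearGroup (Fin 2) ℤ)
    (M : FixedDetMatrix (Fin 2) ℤ N) : (mulRight g M).1 = M.1 * g.1 := rfl

theorem toMatC_scaled_mulRight (g : Matrix.SpecialLinearGroup (Fin 2) ℤ)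
    (M : FixedDetMatrix (Fin 2) ℤ ((ℓ : ℤ) ^ 2)) :
    toMatC (scaled ℓ (mulRight g M)) = toMatC (scaled ℓ M) * toMatC g := by
  ext i j
  rw [toMatC_scaled_apply, mulRight_val, Matrix.mul_apply, Matrix.mul_apply]
  simp only [Fin.sum_univ_two, toMatC_scaled_apply]
  simp only [toMatC, Matrix.map_apply, algebraMap_int_eq, eq_intCast]
  push_cast
  ring

variable {k m : ℕ} {φ : CoordFun} {C : FourierIndex → ℂ}

theorem CoordJacobiForm.slashMat_smul (h : CoordJacobiForm k m φ C)
    (γ : Matrix.SpecialLinearGroup (Fin 2) ℤ) (M : FixedDetMatrix (Fin 2) ℤ ((ℓ : ℤ) ^ 2))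
    {τ z w : ℂ} (hH : InH τ z w) (x y : ℂ) :
    slashMat k m (toMatC (scaled ℓ (γ • M))) φ τ z w x y =
      slashMat k m (toMatC (scaled ℓ M)) φ τ z w x y := by
  have hM := isRealSL_toMatC_rat (scaled ℓ M)
  rw [toMatC_scaled_smul, slashMat_mul (isRealSL_toMatC_int γ) hM φ hH, slashMat]
  rw [h.mat γ _ _ _ _ _ (hM.inH hH)]
  rfl

/-- The summand of the Hecke operator that belongs to the matrix `M`. -/
def heckeTerm (k m ℓ : ℕ) [NeZero ℓ] (φ : CoordFun)
    (M : FixedDetMatrix (Fin 2) ℤ ((ℓ : ℤ) ^ 2)) : CoordFun := fun τ z w x y =>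
  ∑ l ∈ Finset.range ℓ, ∑ u ∈ Finset.range ℓ,
    slashHeis m l u (slashMat k m (toMatC (scaled ℓ M)) φ) τ z w x y

theorem heckeSum_eq_finsum (k m : ℕ) (φ : CoordFun) (τ z w x y : ℂ) :
    heckeSum k m ℓ φ τ z w x y = (ℓ : ℂ) ^ ((k : ℤ) - 4) *
      ∑ᶠ (q : HeckeCosets ℓ) (_ : IsSquare (entriesGcd q.out.1)),
        heckeTerm k m ℓ φ q.out τ z w x y := rfl

theorem CoordJacobiForm.heckeTerm_smul (h : CoordJacobiForm k m φ C)
    (γ : Matrix.SpecialLinearGroup (Fin 2) ℤ) (M : FixedDetMatrix (Fin 2) ℤ ((ℓ : ℤ) ^ 2))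
    {τ z w : ℂ} (hH : InH τ z w) (x y : ℂ) :
    heckeTerm k m ℓ φ (γ • M) τ z w x y = heckeTerm k m ℓ φ M τ z w x y :=
  Finset.sum_congr rfl fun _ _ => Finset.sum_congr rfl fun _ _ =>
    slashHeis_congr m _ _ (fun x y => h.slashMat_smul γ M hH x y) x y

/-- The terms of the Hecke operator are periodic in `x`: the translation by `(0, ℓ)` becomes an
integral element of the Heisenberg group when it is moved past `(1/ℓ) M`. -/
theorem CoordJacobiForm.slashMat_scaled_periodic (h : CoordJacobiForm k m φ C)
    (M : FixedDetMatrix (Fin 2) ℤ ((ℓ : ℤ) ^ 2)) {τ z w : ℂ} (hH : InH τ z w) (x y : ℂ) :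
    slashMat k m (toMatC (scaled ℓ M)) φ τ z w (x + ℓ) y =
      slashMat k m (toMatC (scaled ℓ M)) φ τ z w x y := by
  have hM := isRealSL_toMatC_rat (scaled ℓ M)
  have hℓ : (ℓ : ℂ) ≠ 0 := NeZero.ne _
  -- `(-c, a)` is the second row of the adjugate of `M`, so that `(-c, a) (1/ℓ) M = (0, ℓ)`.
  have h1 := slashMat_slashHeis (k := k) (m := m) hM ((-(M.1 1 0) : ℤ) : ℂ) (M.1 0 0 : ℤ) φ hH x y
  have h2 : slashMat k m (toMatC (scaled ℓ M)) (slashHeis m ((-(M.1 1 0) : ℤ) : ℂ) (M.1 0 0 : ℤ) φ)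
      τ z w x y = slashMat k m (toMatC (scaled ℓ M)) φ τ z w x y := by
    rw [slashMat, h.slashHeis_int _ _ (hM.inH hH)]
    rfl
  have hdet := hM.det_eq_one
  simp only [toMatC_scaled_apply] at h1 hdet
  have e1 : ((-(M.1 1 0) : ℤ) : ℂ) * (M.1 0 0 / ℓ) + (M.1 0 0 : ℤ) * (M.1 1 0 / ℓ) = 0 := by
    push_cast; ring
  have e2 : ((-(M.1 1 0) : ℤ) : ℂ) * (M.1 0 1 / ℓ) + (M.1 0 0 : ℤ) * (M.1 1 1 / ℓ) = ℓ := by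
    push_cast
    field_simp at hdet ⊢
    linear_combination hdet
  rw [h2, e1, e2] at h1
  rw [h1, slashHeis]
  simp

/-- If the sum over the Heisenberg elements is stable under `g`, then `Φ | T^J(ℓ)^↑` is invariant
under `g^↑`, because right multiplication by `g` permutes the cosets. -/
theorem CoordJacobiForm.slashMat_heckeSum (h : CoordJacobiForm k m φ C)
    (g : Matrix.SpecialLinearGroup (Fin 2) ℤ) {τ z w : ℂ} (hH : InH τ z w) (x y : ℂ)
    (hg : ∀ M : FixedDetMatrix (Fin 2) ℤ ((ℓ : ℤ) ^ 2),
      ∑ l ∈ Finset.range ℓ, ∑ u ∈ Finset.range ℓ,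
        slashHeis m (l * toMatC g 0 0 + u * toMatC g 1 0) (l * toMatC g 0 1 + u * toMatC g 1 1)
          (slashMat k m (toMatC (scaled ℓ M)) φ) τ z w x y = heckeTerm k m ℓ φ M τ z w x y) :
    slashMat k m (toMatC g) (heckeSum k m ℓ φ) τ z w x y = heckeSum k m ℓ φ τ z w x y := by
  have hg' := isRealSL_toMatC_int g
  have key : ∀ M : FixedDetMatrix (Fin 2) ℤ ((ℓ : ℤ) ^ 2),
      slashMat k m (toMatC g) (heckeTerm k m ℓ φ M) τ z w x y =
        heckeTerm k m ℓ φ (mulRight g M) τ z w x y := by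
    intro M
    have hM := isRealSL_toMatC_rat (scaled ℓ M)
    rw [← hg, slashMat]
    simp only [heckeTerm]
    rw [Finset.mul_sum]
    refine Finset.sum_congr rfl fun l _ => ?_
    rw [Finset.mul_sum]
    refine Finset.sum_congr rfl fun u _ => ?_
    have h1 := slashMat_slashHeis (k := k) (m := m) hg' l u
      (slashMat k m (toMatC (scaled ℓ M)) φ) hH x y
    rw [slashMat] at h1
    rw [h1]
    refine slashHeis_congr m _ _ (fun x y => ?_) x y
    rw [toMatC_scaled_mulRight, slashMat_mul hM hg' φ hH]
  have hperm := finsum_cosets_mulRight (ℓ := ℓ) (fun M => heckeTerm k m ℓ φ M τ z w x y)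
    (fun γ M => h.heckeTerm_smul γ M hH x y) g
  rw [heckeSum_eq_finsum, ← hperm, slashMat, heckeSum_eq_finsum, mul_left_comm]
  congr 1
  refine (mul_finsum_mem (s := {q : HeckeCosets ℓ | IsSquare (entriesGcd q.out.1)}) _ _).trans ?_
  refine finsum_congr fun q => finsum_congr fun _ => ?_
  rw [← key, slashMat]

/-- Invariance of `Φ | T^J(ℓ)^↑` under `τ ↦ -1/τ`. -/
theorem CoordJacobiForm.slashMat_S_heckeSum (h : CoordJacobiForm k m φ C) {τ z w : ℂ}
    (hH : InH τ z w) (x y : ℂ) :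
    slashMat k m !![0, -1; 1, 0] (heckeSum k m ℓ φ) τ z w x y = heckeSum k m ℓ φ τ z w x y := by
  have hS : toMatC ModularGroup.S = !![0, -1; 1, 0] := by
    ext i j; fin_cases i <;> fin_cases j <;> simp [toMatC, ModularGroup.S]
  rw [← hS]
  refine h.slashMat_heckeSum _ hH x y fun M => ?_
  rw [hS, heckeTerm, Finset.sum_comm]
  refine Finset.sum_congr rfl fun u _ => ?_
  have h1 := sum_range_affine (Nat.pos_of_ne_zero (NeZero.ne ℓ))
    (h := fun v : ℤ => slashHeis m (u : ℤ) v (slashMat k m (toMatC (scaled ℓ M)) φ) τ z w x y)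
    (fun v => slashHeis_periodic (fun x y => h.slashMat_scaled_periodic M hH x y) u v x y)
    (a := -1) ((isCoprime_one_left).neg_left) 0
  simp only [Int.cast_natCast] at h1
  rw [← h1]
  refine Finset.sum_congr rfl fun l _ => ?_
  simp

/-- Invariance of `Φ | T^J(ℓ)^↑` under `τ ↦ τ + 1`. -/
theorem CoordJacobiForm.heckeSum_add_one (h : CoordJacobiForm k m φ C) {τ z w : ℂ}
    (hH : InH τ z w) (x y : ℂ) :
    heckeSum k m ℓ φ (τ + 1) z w x y = heckeSum k m ℓ φ τ z w x y := by
  have hT : toMatC ModularGroup.T = !![1, 1; 0, 1] := by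
    ext i j; fin_cases i <;> fin_cases j <;> simp [toMatC, ModularGroup.T]
  have key := h.slashMat_heckeSum (ℓ := ℓ) ModularGroup.T hH x y fun M => ?_
  · rw [hT] at key
    rw [← key]
    simp [slashMat]
  rw [hT, heckeTerm]
  refine Finset.sum_congr rfl fun l _ => ?_
  have h1 := sum_range_affine (Nat.pos_of_ne_zero (NeZero.ne ℓ))
    (h := fun v : ℤ => slashHeis m (l : ℤ) v (slashMat k m (toMatC (scaled ℓ M)) φ) τ z w x y)
    (fun v => slashHeis_periodic (fun x y => h.slashMat_scaled_periodic M hH x y) l v x y)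
    (a := 1) isCoprime_one_left l
  simp only [Int.cast_natCast] at h1
  rw [← h1]
  refine Finset.sum_congr rfl fun u _ => ?_
  simp [add_comm]

end Scaled

/-- `(1/p) (a, b; 0, d)`. -/
def triMat (p : ℕ) (a b d : ℤ) : Matrix (Fin 2) (Fin 2) ℂ :=
  !![(a : ℂ) / p, (b : ℂ) / p; 0, (d : ℂ) / p]

theorem isRealSL_triMat {p : ℕ} (hp : p ≠ 0) {a d : ℤ} (b : ℤ) (had : a * d = (p : ℤ) ^ 2) :
    IsRealSL (triMat p a b d) := by
  have hp' : (p : ℂ) ≠ 0 := by exact_mod_cast hp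
  have had' : (a : ℂ) * d = (p : ℂ) ^ 2 := by exact_mod_cast had
  constructor
  · intro i j
    fin_cases i <;> fin_cases j <;> simp [triMat]
  · simp only [triMat, Matrix.of_apply, Matrix.cons_val', Matrix.cons_val_zero,
      Matrix.cons_val_fin_one, Matrix.cons_val_one]
    field_simp
    linear_combination had'

theorem slashMat_triMat (k m p : ℕ) (a b d : ℤ) (φ : CoordFun) (τ z w x y : ℂ) :
    slashMat k m (triMat p a b d) φ τ z w x y = (((d : ℂ) / p) ^ k)⁻¹ *
      φ (((a : ℂ) / p * τ + (b : ℂ) / p) / ((d : ℂ) / p)) (z / ((d : ℂ) / p)) w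
        (x / ((d : ℂ) / p)) y := by
  simp [slashMat, triMat]

/-- The summand of the Hecke operator that belongs to the matrix `(a, b; 0, d)`. -/
def triTerm (k m p : ℕ) (φ : CoordFun) (a b d : ℤ) : CoordFun := fun τ z w x y =>
  ∑ l ∈ Finset.range p, ∑ u ∈ Finset.range p,
    slashHeis m l u (slashMat k m (triMat p a b d) φ) τ z w x y

section Triangular

variable {p : ℕ} [hp : Fact p.Prime] {k m : ℕ} {φ : CoordFun} {C : FourierIndex → ℂ}

/-- The Hecke operator as a sum over triangular representatives. -/
theorem CoordJacobiForm.heckeSum_eq (h : CoordJacobiForm k m φ C) {τ z w : ℂ} (hH : InH τ z w)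
    (x y : ℂ) :
    heckeSum k m p φ τ z w x y = (p : ℂ) ^ ((k : ℤ) - 4) *
      (triTerm k m p φ (p ^ 2) 0 1 τ z w x y +
        ∑ b ∈ Finset.Ico 1 p, triTerm k m p φ p b p τ z w x y +
        ∑ b ∈ Finset.range (p ^ 2), triTerm k m p φ 1 b (p ^ 2) τ z w x y) := by
  rw [heckeSum_eq_finsum]
  congr 1
  refine finsum_cosets_eq p (fun M => heckeTerm k m p φ M τ z w x y)
    (fun γ M => h.heckeTerm_smul γ M hH x y) (fun a b d => triTerm k m p φ a b d τ z w x y) ?_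
  intro M hM
  have : toMatC (scaled p M) = triMat p (M.1 0 0) (M.1 0 1) (M.1 1 1) := by
    ext i j
    rw [toMatC_scaled_apply]
    fin_cases i <;> fin_cases j <;> simp [triMat, hM]
  simp only [heckeTerm, this]
  rfl

/-- To compare `Φ | T^J(p)^↑` at two points up to a factor, it suffices to compare the summands of
the triangular representatives. -/
theorem CoordJacobiForm.heckeSum_congr (h : CoordJacobiForm k m φ C) {τ z w τ' z' w' : ℂ}
    (hH : InH τ z w) (hH' : InH τ' z' w') (x y x' y' c : ℂ)
    (key : ∀ (a b d : ℤ) (l u : ℕ), a * d = (p : ℤ) ^ 2 →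
      c * slashHeis m l u (slashMat k m (triMat p a b d) φ) τ z w x y =
        slashHeis m l u (slashMat k m (triMat p a b d) φ) τ' z' w' x' y') :
    c * heckeSum k m p φ τ z w x y = heckeSum k m p φ τ' z' w' x' y' := by
  have key' : ∀ a b d : ℤ, a * d = (p : ℤ) ^ 2 →
      c * triTerm k m p φ a b d τ z w x y = triTerm k m p φ a b d τ' z' w' x' y' := by
    intro a b d had
    simp only [triTerm, Finset.mul_sum]
    exact Finset.sum_congr rfl fun l _ => Finset.sum_congr rfl fun u _ => key a b d l u had
  rw [h.heckeSum_eq hH, h.heckeSum_eq hH', mul_left_comm]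
  congr 1
  rw [mul_add, mul_add, Finset.mul_sum, Finset.mul_sum, key' _ _ _ (by ring)]
  congr 1
  · congr 1
    exact Finset.sum_congr rfl fun b _ => key' _ _ _ (by ring)
  · exact Finset.sum_congr rfl fun b _ => key' _ _ _ (by ring)

/-- `Φ | T^J(p)^↑` has the period `p` in `z`, because `z` enters the summand of `(a, b; 0, d)` as
`z / (d / p) = a z / p`. -/
theorem CoordJacobiForm.heckeSum_add_p (h : CoordJacobiForm k m φ C) {τ z w : ℂ} (hH : InH τ z w)
    (x y : ℂ) : heckeSum k m p φ τ (z + p) w x y = heckeSum k m p φ τ z w x y := by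
  have hp0 := hp.out.ne_zero
  have hH' : InH τ (z + p) w := by simpa using hH.add_int 0 p 0
  rw [← one_mul (heckeSum k m p φ τ (z + p) w x y)]
  refine h.heckeSum_congr hH' hH x y x y 1 fun a b d l u had => ?_
  have hp' : (p : ℂ) ≠ 0 := by exact_mod_cast hp0
  have had' : (a : ℂ) * d = (p : ℂ) ^ 2 := by exact_mod_cast had
  have hd : (d : ℂ) ≠ 0 := by
    intro hd
    rw [hd, mul_zero] at had'
    exact pow_ne_zero 2 hp' had'.symm
  have hin := (isRealSL_triMat hp0 b had).inH hH
  simp only [triMat, Matrix.of_apply, Matrix.cons_val', Matrix.cons_val_zero,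
    Matrix.cons_val_fin_one, Matrix.cons_val_one, zero_mul, zero_add, zero_div, sub_zero] at hin
  have h1 := h.add_int ((x + l * τ + u) / ((d : ℂ) / p)) (y + l * z) hin 0 a 0 0 (l * p)
  simp only [slashHeis, slashMat_triMat, one_mul]
  rw [← h1]
  have e1 : (z + p) / ((d : ℂ) / p) = z / ((d : ℂ) / p) + a := by
    field_simp
    linear_combination -had'
  have e2 : y + l * (z + p) = y + l * z + ((l * p : ℤ) : ℂ) := by push_cast; ring
  rw [e1, e2]
  simp

theorem CoordJacobiForm.heckeSum_add_one_right (h : CoordJacobiForm k m φ C) {τ z w : ℂ}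
    (hH : InH τ z w) (x y : ℂ) :
    heckeSum k m p φ τ z (w + 1) x y = heckeSum k m p φ τ z w x y := by
  have hp0 := hp.out.ne_zero
  have hH' : InH τ z (w + 1) := by simpa using hH.add_int 0 0 1
  rw [← one_mul (heckeSum k m p φ τ z (w + 1) x y)]
  refine h.heckeSum_congr hH' hH x y x y 1 fun a b d l u had => ?_
  have hin := (isRealSL_triMat hp0 b had).inH hH
  simp only [triMat, Matrix.of_apply, Matrix.cons_val', Matrix.cons_val_zero,
    Matrix.cons_val_fin_one, Matrix.cons_val_one, zero_mul, zero_add, zero_div, sub_zero] at hin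
  have h1 := h.add_int ((x + l * τ + u) / ((d : ℂ) / p)) (y + l * z) hin 0 0 1 0 0
  simp only [slashHeis, slashMat_triMat, one_mul]
  rw [← h1]
  simp

/-- `Φ | T^J(p)^↓` is invariant under `τ ↦ -1/τ`, because the two embedded groups commute. -/
theorem CoordJacobiForm.slashMat_S_flip_heckeSum (h : CoordJacobiForm k m φ C) {τ z w : ℂ}
    (hH : InH τ z w) (x y : ℂ) :
    slashMat k m !![0, -1; 1, 0] (HeckeJacobi.flip (heckeSum k m p (HeckeJacobi.flip φ)))
        τ z w x y =
      HeckeJacobi.flip (heckeSum k m p (HeckeJacobi.flip φ)) τ z w x y := by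
  have hp0 := hp.out.ne_zero
  have hp' : (p : ℂ) ≠ 0 := by exact_mod_cast hp0
  have hS : toMatC ModularGroup.S = !![0, -1; 1, 0] := by
    ext i j; fin_cases i <;> fin_cases j <;> simp [toMatC, ModularGroup.S]
  have hτ : τ ≠ 0 := by
    intro h0
    have := hH.im_pos
    rw [h0] at this
    simp at this
  have hSH := (isRealSL_toMatC_int ModularGroup.S).inH hH
  rw [hS] at hSH
  simp only [slashMat, Matrix.of_apply, Matrix.cons_val', Matrix.cons_val_zero,
    Matrix.cons_val_fin_one, Matrix.cons_val_one, one_mul, add_zero, zero_mul, zero_add] at hSH ⊢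
  refine h.flip.heckeSum_congr hSH.symm hH.symm _ _ _ _ _ fun a b d l u had => ?_
  have had' : (a : ℂ) * d = (p : ℂ) ^ 2 := by exact_mod_cast had
  have hd : (d : ℂ) ≠ 0 := by
    intro hd
    rw [hd, mul_zero] at had'
    exact pow_ne_zero 2 hp' had'.symm
  have hin := ((isRealSL_triMat hp0 b had).inH hH.symm).symm
  simp only [triMat, Matrix.of_apply, Matrix.cons_val', Matrix.cons_val_zero,
    Matrix.cons_val_fin_one, Matrix.cons_val_one, zero_mul, zero_add, zero_div, sub_zero] at hin
  have h1 := h.mat ModularGroup.S _ _ _ (x + l * z) ((y + l * w + u) / ((d : ℂ) / p)) hin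
  rw [hS] at h1
  simp only [slashMat, Matrix.of_apply, Matrix.cons_val', Matrix.cons_val_zero,
    Matrix.cons_val_fin_one, Matrix.cons_val_one, one_mul, add_zero, zero_mul, zero_add] at h1
  simp only [slashHeis, slashMat_triMat, HeckeJacobi.flip]
  rw [← h1]
  have e1 : z / τ / ((d : ℂ) / p) = z / ((d : ℂ) / p) / τ := by field_simp
  have e2 : ((a : ℂ) / p * (w - z ^ 2 / τ) + b / p) / ((d : ℂ) / p) =
      ((a : ℂ) / p * w + b / p) / ((d : ℂ) / p) - (z / ((d : ℂ) / p)) ^ 2 / τ := by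
    field_simp
    linear_combination (-(z ^ 2)) * had'
  have e3 : (y - z * x / τ + l * (w - z ^ 2 / τ) + u) / ((d : ℂ) / p) =
      (y + l * w + u) / ((d : ℂ) / p) - z / ((d : ℂ) / p) * (x + l * z) / τ := by
    field_simp
    ring
  have e4 : x / τ + l * (z / τ) = (x + l * z) / τ := by ring
  have e5 : (e (m * (x ^ 2 / τ)))⁻¹ *
      e (m * ((l : ℂ) ^ 2 * (w - z ^ 2 / τ) + 2 * l * (y - z * x / τ) + u * l)) =
      e (m * ((l : ℂ) ^ 2 * w + 2 * l * y + u * l)) * (e (m * ((x + l * z) ^ 2 / τ)))⁻¹ := by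
    rw [← e_neg, ← e_neg, ← e_add, ← e_add]
    congr 1
    ring
  rw [e1, e2, e3, e4, mul_inv, mul_inv]
  linear_combination ((τ ^ k)⁻¹ * (((d : ℂ) / p) ^ k)⁻¹ * φ (-1 / τ) (z / ((d : ℂ) / p) / τ)
    (((a : ℂ) / p * w + b / p) / ((d : ℂ) / p) - (z / ((d : ℂ) / p)) ^ 2 / τ) ((x + l * z) / τ)
    ((y + l * w + u) / ((d : ℂ) / p) - z / ((d : ℂ) / p) * (x + l * z) / τ)) * e5

end Triangular

/-! ### A vanishing criterion -/

/-- A function with the invariance properties of `Φ | (T^J(p)^↑ - T^J(p)^↓)` vanishes as soon as its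
average over the translations `z ↦ z + j` does. Transporting the average by `τ ↦ -1/τ` and by
`τ ↦ τ + t` shows that the values at the images under the unipotent substitutions that send `z` to
`z + s τ + t`, with `0 ≤ s < p` and `t` modulo `p`, sum to zero over every line in the
`(s, t)`-plane that is vertical or passes through the origin. Adding up the lines through the origin
that are not vertical, and removing the vertical lines `s ≠ 0`, leaves `p` times the value at the
origin. -/
theorem eq_zero_of_sum_translates {p : ℕ} [hp : Fact p.Prime] {k m : ℕ} {f : CoordFun}
    (hS : ∀ τ z w x y, InH τ z w → slashMat k m !![0, -1; 1, 0] f τ z w x y = f τ z w x y)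
    (hτ : ∀ τ z w x y, InH τ z w → f (τ + 1) z w x y = f τ z w x y)
    (hw : ∀ τ z w x y, InH τ z w → f τ z (w + 1) x y = f τ z w x y)
    (hz : ∀ τ z w x y, InH τ z w → f τ (z + p) w x y = f τ z w x y)
    (hsum : ∀ τ z w x y, InH τ z w → ∑ j ∈ Finset.range p, f τ (z + j) w x y = 0)
    {τ z w : ℂ} (hH : InH τ z w) (x y : ℂ) : f τ z w x y = 0 := by
  have hp0 := hp.out.pos
  have hτn : ∀ (n : ℕ) τ z w x y, InH τ z w → f (τ + n) z w x y = f τ z w x y := by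
    intro n
    induction n with
    | zero => intro τ z w x y _; simp
    | succ n ih =>
      intro τ z w x y h
      have h' : InH (τ + n) z w := by simpa using h.add_int n 0 0
      rw [← ih τ z w x y h, ← hτ _ _ _ _ _ h']
      push_cast
      rw [add_assoc]
  have hwn : ∀ (n : ℕ) τ z w x y, InH τ z w → f τ z (w + n) x y = f τ z w x y := by
    intro n
    induction n with
    | zero => intro τ z w x y _; simp
    | succ n ih =>
      intro τ z w x y h
      have h' : InH τ z (w + n) := by simpa using h.add_int 0 0 n
      rw [← ih τ z w x y h, ← hw _ _ _ _ _ h']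
      push_cast
      rw [add_assoc]
  -- The transform of the relation `hsum` under `τ ↦ -1/τ`.
  have hshear : ∀ τ z w x y, InH τ z w → ∑ j ∈ Finset.range p,
      f τ (z + j * τ) (w + 2 * j * z + j ^ 2 * τ) x (y + j * x) = 0 := by
    intro τ z w x y h
    have hne : τ ≠ 0 := by
      intro h0
      have := h.im_pos
      rw [h0] at this
      simp at this
    have hSreal : IsRealSL !![0, -1; 1, 0] := by
      refine ⟨fun i j => ?_, by simp⟩
      fin_cases i <;> fin_cases j <;> simp
    have hSH := hSreal.inH h
    simp only [Matrix.of_apply, Matrix.cons_val', Matrix.cons_val_zero,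
      Matrix.cons_val_fin_one, Matrix.cons_val_one, one_mul, add_zero, zero_mul, zero_add] at hSH
    have h1 := hsum _ _ _ (x / τ) (y - z * x / τ) hSH
    have h2 : ∀ j ∈ Finset.range p,
        f τ (z + j * τ) (w + 2 * j * z + j ^ 2 * τ) x (y + j * x) =
          (τ ^ k * e (m * (x ^ 2 / τ)))⁻¹ *
            f (-1 / τ) (z / τ + j) (w - z ^ 2 / τ) (x / τ) (y - z * x / τ) := by
      intro j _
      have h3 : InH τ (z + j * τ) (w + 2 * j * z + j ^ 2 * τ) := by simpa using h.shear j
      rw [← hS _ _ _ _ _ h3]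
      simp only [slashMat, Matrix.of_apply, Matrix.cons_val', Matrix.cons_val_zero,
        Matrix.cons_val_fin_one, Matrix.cons_val_one, one_mul, add_zero, zero_mul, zero_add]
      congr 2
      · field_simp
      · field_simp; ring
      · field_simp; ring
    rw [Finset.sum_congr rfl h2, ← Finset.mul_sum, h1, mul_zero]
  -- The value at the point `(s, t)` of the plane.
  let g : ℤ → ℤ → ℂ := fun s t => f τ (z + s * τ + t) (w + 2 * s * z + s ^ 2 * τ) x (y + s * x)
  have hg1 : ∀ t : ℕ, ∑ j ∈ Finset.range p, g j (j * t) = 0 := by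
    intro t
    have h' : InH (τ + t) z w := by simpa using hH.add_int t 0 0
    rw [← hshear (τ + t) z w x y h']
    refine Finset.sum_congr rfl fun j _ => ?_
    have h3 := (hH.shear j).add_int 0 (j * t) 0
    have h4 := (hH.shear j).add_int 0 (j * t) (j ^ 2 * t)
    simp only [g]
    push_cast at h3 h4 ⊢
    rw [add_zero] at h3 h4
    rw [add_zero] at h3
    have e1 : z + j * (τ + t) = z + j * τ + j * t := by ring
    have e2 : w + 2 * j * z + (j : ℂ) ^ 2 * (τ + t) =
        w + 2 * j * z + j ^ 2 * τ + ((j ^ 2 * t : ℕ) : ℂ) := by push_cast; ring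
    rw [e1, e2, hτn _ _ _ _ _ _ (by push_cast; exact h4), hwn _ _ _ _ _ _ h3]
  have hg2 : ∀ j : ℕ, ∑ t ∈ Finset.range p, g j t = 0 := by
    intro j
    have h3 := hH.shear j
    have h5 := hsum _ _ _ x (y + j * x) h3
    simpa [g] using h5
  have hper : ∀ s t, g s (t + p) = g s t := by
    intro s t
    have h3 := (hH.shear s).add_int 0 t 0
    simp only [Int.cast_zero, add_zero] at h3
    have h4 := hz _ _ _ x (y + s * x) h3
    simp only [g]
    push_cast
    rw [← h4]
    congr 1
    ring
  have hg3 : ∀ j ∈ Finset.range p, j ≠ 0 → ∑ t ∈ Finset.range p, g j (j * t) = 0 := by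
    intro j hj hj0
    have hcop : IsCoprime (j : ℤ) p := by
      rw [Nat.isCoprime_iff_coprime]
      exact (Nat.coprime_of_lt_prime hj0 (Finset.mem_range.1 hj) hp.out).symm
    have h1 := sum_range_affine hp0 (h := g j) (hper j) hcop 0
    simp only [add_zero] at h1
    rw [h1, hg2]
  have htotal : ∑ j ∈ Finset.range p, ∑ t ∈ Finset.range p, g j (j * t) = 0 := by
    rw [Finset.sum_comm]
    exact Finset.sum_eq_zero fun t _ => hg1 t
  rw [Finset.sum_eq_single_of_mem 0 (Finset.mem_range.2 hp0) hg3] at htotal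
  have h0 : g 0 0 = f τ z w x y := by simp [g]
  simpa [h0, hp.out.ne_zero] using htotal

/-! ### Exponential sums -/

theorem e_eq_one_iff (x : ℂ) : e x = 1 ↔ ∃ n : ℤ, x = n := by
  rw [e, Complex.exp_eq_one_iff]
  have h : (2 * Real.pi * Complex.I : ℂ) ≠ 0 := Complex.two_pi_I_ne_zero
  refine exists_congr fun n => ⟨fun h1 => ?_, fun h1 => by rw [h1]; ring⟩
  apply mul_left_cancel₀ h
  rw [h1]; ring

theorem sum_e_div (N : ℕ) (hN : 0 < N) (n : ℤ) :
    ∑ b ∈ Finset.range N, e (n * b / N) = if (N : ℤ) ∣ n then (N : ℂ) else 0 := by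
  have hN' : (N : ℂ) ≠ 0 := by exact_mod_cast hN.ne'
  split_ifs with h
  · obtain ⟨c, rfl⟩ := h
    have h1 : ∀ b ∈ Finset.range N, e (((N * c : ℤ) : ℂ) * b / N) = 1 := by
      intro b _
      have : ((N * c : ℤ) : ℂ) * b / N = ((c * b : ℤ) : ℂ) := by
        push_cast; field_simp
      rw [this, e_intCast]
    rw [Finset.sum_congr rfl h1]
    simp
  · have hpow : ∀ b : ℕ, e (n * b / N) = e (n / N) ^ b := by
      intro b
      simp only [e, ← Complex.exp_nat_mul]
      congr 1
      ring
    have hne : e (n / N) ≠ 1 := by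
      intro h1
      obtain ⟨c, hc⟩ := (e_eq_one_iff _).1 h1
      apply h
      refine ⟨c, ?_⟩
      field_simp at hc
      exact_mod_cast hc
    have h1 : e (n / N) ^ N = 1 := by
      rw [← hpow, mul_div_cancel_right₀ _ hN', e_intCast]
    simp only [hpow]
    rw [geom_sum_eq hne, h1, sub_self, zero_div]

theorem sum_e_div_Ico {p : ℕ} (hp : 0 < p) (n : ℤ) :
    ∑ b ∈ Finset.Ico 1 p, e (n * b / p) = (if (p : ℤ) ∣ n then (p : ℂ) else 0) - 1 := by
  rw [← sum_e_div p hp, Finset.range_eq_Ico, Finset.sum_eq_sum_Ico_succ_bot hp]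
  simp

/-- The number of roots modulo `p` of a quadratic polynomial, in terms of its discriminant. -/
theorem card_quadratic_roots {p : ℕ} [hp : Fact p.Prime] {m : ℕ} (hpm : p.Coprime (2 * m))
    (a r : ℤ) :
    (((Finset.range p).filter fun l : ℕ => (p : ℤ) ∣ a - r * l + m * (l : ℤ) ^ 2).card : ℤ) =
      legendreSym p (r ^ 2 - 4 * m * a) + 1 := by
  have hp2 : p ≠ 2 := by
    rintro rfl
    exact absurd (Nat.Coprime.eq_one_of_dvd hpm (dvd_mul_right 2 m)) (by norm_num)
  rw [← legendreSym.card_sqrts p hp2]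
  congr 1
  have hu : ((2 * m : ℕ) : ZMod p) ≠ 0 := by
    rw [Ne, ZMod.natCast_eq_zero_iff]
    intro h
    exact hp.out.one_lt.ne' (Nat.Coprime.eq_one_of_dvd hpm h)
  push_cast at hu
  have h2 : (2 : ZMod p) ≠ 0 := left_ne_zero_of_mul hu
  have hm : (m : ZMod p) ≠ 0 := right_ne_zero_of_mul hu
  -- Completing the square.
  have key : ∀ x : ZMod p, ((a : ZMod p) - r * x + m * x ^ 2 = 0) ↔
      (2 * m * x - r) ^ 2 = ((r ^ 2 - 4 * m * a : ℤ) : ZMod p) := by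
    intro x
    push_cast
    constructor
    · intro h
      linear_combination 4 * m * h
    · intro h
      have h4 : (4 * m : ZMod p) ≠ 0 := by
        have : (4 * m : ZMod p) = 2 * (2 * m) := by ring
        rw [this]
        exact mul_ne_zero h2 hu
      apply mul_left_cancel₀ h4
      linear_combination h
  have hdvd : ∀ l : ℕ, (p : ℤ) ∣ a - r * l + m * (l : ℤ) ^ 2 ↔
      ((a : ZMod p) - r * (l : ZMod p) + m * (l : ZMod p) ^ 2 = 0) := by
    intro l
    rw [← ZMod.intCast_zmod_eq_zero_iff_dvd]
    push_cast
    rfl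
  refine Finset.card_nbij' (fun l : ℕ => (2 * m * (l : ZMod p) - r))
    (fun x => ((x + r) * (2 * m : ZMod p)⁻¹).val) ?_ ?_ ?_ ?_
  · intro l hl
    simp only [Finset.coe_filter, Set.mem_ofPred_eq, Set.coe_toFinset] at hl ⊢
    exact (key _).1 ((hdvd l).1 hl.2)
  · intro x hx
    simp only [Finset.coe_filter, Set.mem_ofPred_eq, Set.coe_toFinset, Finset.mem_range] at hx ⊢
    refine ⟨ZMod.val_lt _, ?_⟩
    rw [hdvd, key, ZMod.natCast_zmod_val, ← hx]
    congr 1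
    field_simp
    ring
  · intro l hl
    simp only [Finset.coe_filter, Set.mem_ofPred_eq, Finset.mem_range] at hl
    have : ((2 * m * (l : ZMod p) - r) + r) * (2 * m : ZMod p)⁻¹ = l := by
      field_simp
      ring
    simp only [this]
    exact ZMod.val_cast_of_lt hl.1
  · intro x _
    simp only [ZMod.natCast_zmod_val]
    field_simp
    ring

theorem sum_quadratic_roots {p : ℕ} [hp : Fact p.Prime] {m : ℕ} (hpm : p.Coprime (2 * m))
    (a r : ℤ) :
    ∑ l ∈ Finset.range p,
        ((if (p : ℤ) ∣ a - r * l + m * (l : ℤ) ^ 2 then (p : ℂ) else 0) - 1) =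
      p * legendreSym p (r ^ 2 - 4 * m * a) := by
  rw [Finset.sum_sub_distrib, ← Finset.sum_filter, Finset.sum_const, Finset.sum_const,
    Finset.card_range]
  have h : (((Finset.range p).filter fun l : ℕ =>
      (p : ℤ) ∣ a - r * l + m * (l : ℤ) ^ 2).card : ℂ) =
      legendreSym p (r ^ 2 - 4 * m * a) + 1 := by
    exact_mod_cast congrArg (Int.cast : ℤ → ℂ) (card_quadratic_roots hpm a r)
  rw [nsmul_eq_mul, nsmul_eq_mul, h]
  ring

/-! ### The Fourier coefficients of the averaged Hecke operator -/

namespace FourierIndex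

/-- The index of `φ (p² τ, p z, w, p x, y)` that belongs to the index `n` of `φ`. -/
def scale (p : ℕ) (n : FourierIndex) : FourierIndex :=
  ⟨p ^ 2 * n.n₁₁, p * n.n₁₂, n.n₂₂, p * n.r₁, n.r₂⟩

theorem scale_injective {p : ℕ} (hp : p ≠ 0) : Function.Injective (scale p) := by
  have hp' : (p : ℤ) ≠ 0 := by exact_mod_cast hp
  intro n n' h
  simp only [scale, FourierIndex.mk.injEq, mul_eq_mul_left_iff, hp', pow_eq_zero_iff, ne_eq,
    OfNat.ofNat_ne_zero, not_false_eq_true, or_false] at h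
  exact FourierIndex.ext h.1 h.2.1 h.2.2.1 h.2.2.2.1 h.2.2.2.2

theorem mem_range_scale {p : ℕ} (n : FourierIndex) :
    n ∈ Set.range (scale p) ↔ (p : ℤ) ^ 2 ∣ n.n₁₁ ∧ (p : ℤ) ∣ n.n₁₂ ∧ (p : ℤ) ∣ n.r₁ := by
  constructor
  · rintro ⟨n, rfl⟩
    exact ⟨dvd_mul_right _ _, dvd_mul_right _ _, dvd_mul_right _ _⟩
  · rintro ⟨⟨a, ha⟩, ⟨b, hb⟩, ⟨c, hc⟩⟩
    exact ⟨⟨a, b, n.n₂₂, c, n.r₂⟩, FourierIndex.ext ha.symm hb.symm rfl hc.symm rfl⟩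

theorem D₁_scale (m p : ℕ) (n : FourierIndex) : (scale p n).D₁ m = n.D₁ m * p ^ 2 := by
  simp only [D₁_eq, scale]; push_cast; ring

theorem D₂_scale (m p : ℕ) (n : FourierIndex) : (scale p n).D₂ m = n.D₂ m := by
  simp only [D₂_eq, scale]

theorem D_scale (m p : ℕ) (n : FourierIndex) : (scale p n).D m = n.D m * p := by
  simp only [D_eq, scale]; push_cast; ring

theorem r₁_scale (m p : ℕ) (n : FourierIndex) :
    ((scale p n).r₁ : ZMod (2 * m)) = p * n.r₁ := by
  simp [scale]

theorem shift_mul_add_scale (m p : ℕ) (q l : ℤ) (n : FourierIndex) :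
    shift m (p * q + l) (scale p n) = shift m l (scale p (shift m q n)) := by
  ext <;> simp only [shift, scale] <;> ring

end FourierIndex

theorem inv_mul_natCast {p m : ℕ} (hpm : p.Coprime (2 * m)) (r : ZMod (2 * m)) :
    (p : ZMod (2 * m))⁻¹ * (p * r) = r := by
  rw [← mul_assoc, mul_comm _ (p : ZMod (2 * m)), ZMod.coe_mul_inv_eq_one p hpm, one_mul]

theorem mul_natCast_inv {p m : ℕ} (hpm : p.Coprime (2 * m)) (r : ZMod (2 * m)) :
    p * ((p : ZMod (2 * m))⁻¹ * r) = r := by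
  rw [← mul_assoc, ZMod.coe_mul_inv_eq_one p hpm, one_mul]

section

variable {p : ℕ} [hp : Fact p.Prime] {k m : ℕ} {φ : CoordFun} {C : FourierIndex → ℂ}

theorem CoordJacobiForm.hasSum_slash (h : CoordJacobiForm k m φ C) {a d : ℤ} (b : ℤ)
    (had : a * d = (p : ℤ) ^ 2) (l u : ℂ) {τ z w : ℂ} (hH : InH τ z w) (x y : ℂ) :
    HasSum (fun n : FourierIndex => C n * ((((d : ℂ) / p) ^ k)⁻¹ *
        e (m * (l ^ 2 * τ + 2 * l * x + u * l) +
          n.phase (((a : ℂ) / p * τ + (b : ℂ) / p) / ((d : ℂ) / p)) (z / ((d : ℂ) / p)) w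
            ((x + l * τ + u) / ((d : ℂ) / p)) (y + l * z))))
      (slashHeis m l u (slashMat k m (triMat p a b d) φ) τ z w x y) := by
  have hin := (isRealSL_triMat hp.out.ne_zero b had).inH hH
  simp only [triMat, Matrix.of_apply, Matrix.cons_val', Matrix.cons_val_zero,
    Matrix.cons_val_fin_one, Matrix.cons_val_one, zero_mul, zero_add, zero_div, sub_zero] at hin
  have h1 := (h.hasSum _ _ _ ((x + l * τ + u) / ((d : ℂ) / p)) (y + l * z) hin).mul_left
    (e (m * (l ^ 2 * τ + 2 * l * x + u * l)) * (((d : ℂ) / p) ^ k)⁻¹)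
  rw [slashHeis, slashMat_triMat, ← mul_assoc]
  refine h1.congr_fun fun n => ?_
  rw [e_add]
  ring

/-- An index whose invariants are obtained from those of `n₀` by division by `p` comes from exactly
one `l` modulo `p`. -/
theorem CoordJacobiForm.sum_extend (hm : 0 < m) (hpm : p.Coprime (2 * m))
    (h : CoordJacobiForm k m φ C) (n : FourierIndex) :
    ∑ l ∈ Finset.range p,
        Function.extend (fun n => (n.scale p).shift m (l : ℤ)) C (fun _ => 0) n =
      coeff m C ((p : ZMod (2 * m))⁻¹ * n.r₁) n.r₂ (n.D₁ m / p ^ 2) (n.D₂ m) (n.D m / p) := by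
  have hp0 := hp.out.ne_zero
  have hpq : (p : ℚ) ≠ 0 := by exact_mod_cast hp0
  have hinj : ∀ l : ℤ, Function.Injective fun n : FourierIndex => (n.scale p).shift m l :=
    fun l => (FourierIndex.shiftEquiv m l).injective.comp (FourierIndex.scale_injective hp0)
  by_cases hex : ∃ n' : FourierIndex, (n'.r₁ : ZMod (2 * m)) = (p : ZMod (2 * m))⁻¹ * n.r₁ ∧
      (n'.r₂ : ZMod (2 * m)) = n.r₂ ∧ n'.D₁ m = n.D₁ m / p ^ 2 ∧ n'.D₂ m = n.D₂ m ∧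
      n'.D m = n.D m / p
  · obtain ⟨n', h1, h2, h3, h4, h5⟩ := hex
    rw [h.coeff_eq hm h1 h2 h3 h4 h5]
    -- Adjust `n'` so that its second linear coefficient is that of `n`.
    obtain ⟨l', hl'⟩ := FourierIndex.exists_shift (n := n'.flip) h2
    have hC := h.flip.coeff_shift l' n'.flip
    simp only [Function.comp, FourierIndex.flip_flip] at hC
    set n₁ := (n'.flip.shift m l').flip with hn₁
    have h1' : ((n₁.scale p).r₁ : ZMod (2 * m)) = n.r₁ := by
      rw [FourierIndex.r₁_scale]
      have : (n₁.r₁ : ZMod (2 * m)) = (p : ZMod (2 * m))⁻¹ * n.r₁ := h1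
      rw [this, mul_natCast_inv hpm]
    have h3' : n₁.D₁ m = n.D₁ m / p ^ 2 := by
      rw [hn₁, FourierIndex.D₁_flip, FourierIndex.D₂_shift, FourierIndex.D₂_flip, h3]
    have h4' : n₁.D₂ m = n.D₂ m := by
      rw [hn₁, FourierIndex.D₂_flip, FourierIndex.D₁_shift, FourierIndex.D₁_flip, h4]
    have h5' : n₁.D m = n.D m / p := by
      rw [hn₁, FourierIndex.D_flip, FourierIndex.D_shift, FourierIndex.D_flip, h5]
    obtain ⟨ν, hν⟩ := FourierIndex.exists_shift h1'
    have hn : (n₁.scale p).shift m ν = n := by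
      refine FourierIndex.ext_of_D hm hν hl' ?_ ?_ ?_
      · rw [FourierIndex.D₁_shift, FourierIndex.D₁_scale, h3']; field_simp
      · rw [FourierIndex.D₂_shift, FourierIndex.D₂_scale, h4']
      · rw [FourierIndex.D_shift, FourierIndex.D_scale, h5']; field_simp
    have hpz : (p : ℤ) ≠ 0 := by exact_mod_cast hp0
    have hl0 := Int.emod_nonneg ν hpz
    have hl1 := Int.emod_lt_of_pos ν (by positivity : 0 < (p : ℤ))
    obtain ⟨l, hl⟩ := Int.eq_ofNat_of_zero_le hl0
    have hlp : l < p := by omega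
    have hn2 : ((n₁.shift m (ν / p)).scale p).shift m l = n := by
      rw [← FourierIndex.shift_mul_add_scale, ← hl, Int.mul_ediv_add_emod, hn]
    rw [Finset.sum_eq_single_of_mem l (Finset.mem_range.2 hlp)]
    · have := (hinj l).extend_apply C (fun _ => 0) (n₁.shift m (ν / p))
      simp only [hn2] at this
      rw [this, h.coeff_shift, hC]
    · intro l₂ hl₂ hne
      rw [Function.extend_apply']
      rintro ⟨n₂, hn₂⟩
      apply hne
      have hr : ((n₂.scale p).shift m l₂).r₁ = (((n₁.shift m (ν / p)).scale p).shift m l).r₁ := by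
        rw [hn2]; exact congrArg FourierIndex.r₁ hn₂
      have hdvd : (p : ℤ) ∣ ((2 * m : ℕ) : ℤ) * ((l₂ : ℤ) - l) := by
        refine ⟨(n₁.shift m (ν / p)).r₁ - n₂.r₁, ?_⟩
        simp only [FourierIndex.shift, FourierIndex.scale] at hr ⊢
        push_cast
        linear_combination hr
      have hd2 := (Nat.isCoprime_iff_coprime.2 hpm).dvd_of_dvd_mul_left hdvd
      have h6 := Int.eq_zero_of_abs_lt_dvd hd2 (by
        have := Finset.mem_range.1 hl₂
        rw [abs_lt]; omega)
      omega
  · rw [coeff_eq_zero fun n' h1 h2 h3 h4 h5 => hex ⟨n', h1, h2, h3, h4, h5⟩]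
    refine Finset.sum_eq_zero fun l _ => ?_
    rw [Function.extend_apply']
    rintro ⟨n', rfl⟩
    refine hex ⟨n', ?_, rfl, ?_, ?_, ?_⟩
    · rw [FourierIndex.r₁_shift, FourierIndex.r₁_scale, inv_mul_natCast hpm]
    · rw [FourierIndex.D₁_shift, FourierIndex.D₁_scale]; field_simp
    · rw [FourierIndex.D₂_shift, FourierIndex.D₂_scale]
    · rw [FourierIndex.D_shift, FourierIndex.D_scale]; field_simp


/-- The contribution of the representative `(p², 0; 0, 1)`. The sums over `j` and the second
Heisenberg coordinate are constant; the sum over the first one is evaluated by `sum_extend`. -/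
theorem CoordJacobiForm.hasSum_triTerm_sq_one (hm : 0 < m) (hpm : p.Coprime (2 * m))
    (h : CoordJacobiForm k m φ C) {τ z w : ℂ} (hH : InH τ z w) (x y : ℂ) :
    HasSum (fun n : FourierIndex => (p : ℂ) ^ (k + 2) *
        coeff m C ((p : ZMod (2 * m))⁻¹ * n.r₁) n.r₂ (n.D₁ m / p ^ 2) (n.D₂ m) (n.D m / p) *
          e (n.phase τ z w x y))
      (∑ j ∈ Finset.range p, triTerm k m p φ (p ^ 2) 0 1 τ (z + j) w x y) := by
  have hp0 := hp.out.ne_zero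
  have hp' : (p : ℂ) ≠ 0 := by exact_mod_cast hp0
  have hinj : ∀ l : ℤ, Function.Injective fun n : FourierIndex => (n.scale p).shift m l :=
    fun l => (FourierIndex.shiftEquiv m l).injective.comp (FourierIndex.scale_injective hp0)
  have key : ∀ j l u : ℕ, HasSum (fun n : FourierIndex =>
      Function.extend (fun n => (n.scale p).shift m (l : ℤ)) C (fun _ => 0) n *
        ((p : ℂ) ^ k * e (n.phase τ z w x y)))
      (slashHeis m l u (slashMat k m (triMat p (p ^ 2) 0 1) φ) τ (z + j) w x y) := by
    intro j l u
    have hj : InH τ (z + j) w := by simpa using hH.add_int 0 j 0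
    rw [← (hinj l).hasSum_iff]
    · refine (h.hasSum_slash 0 (mul_one _) l u hj x y).congr_fun fun n => ?_
      simp only [Function.comp, (hinj l).extend_apply]
      congr 2
      · push_cast
        rw [← inv_pow, inv_div, div_one]
      · rw [← e_add_intCast _ (m * u * l + p * j * n.n₁₂ + n.r₁ * p * u + n.r₂ * l * j)]
        congr 1
        simp only [FourierIndex.phase, FourierIndex.shift, FourierIndex.scale]
        push_cast
        field_simp
        ring
    · intro n hn
      rw [Function.extend_apply' _ _ _ (by simpa using hn), zero_mul]
  have h1 := hasSum_sum fun j (_ : j ∈ Finset.range p) =>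
    hasSum_sum fun l (_ : l ∈ Finset.range p) =>
      hasSum_sum fun u (_ : u ∈ Finset.range p) => key j l u
  refine h1.congr_fun fun n => ?_
  simp only [Finset.sum_const, Finset.card_range, nsmul_eq_mul, ← Finset.mul_sum,
    ← Finset.sum_mul, h.sum_extend hm hpm]
  ring

/-- The contribution of the representatives `(p, b; 0, p)`. The sum over `b` detects the
divisibility of the first diagonal entry by `p`, and the sum over the first Heisenberg coordinate
then counts the roots of a quadratic polynomial. -/
theorem CoordJacobiForm.hasSum_triTerm_diag (hpm : p.Coprime (2 * m))
    (h : CoordJacobiForm k m φ C) {τ z w : ℂ} (hH : InH τ z w) (x y : ℂ) :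
    HasSum (fun n : FourierIndex => (p : ℂ) ^ 3 *
        (legendreSym p (n.r₁ ^ 2 - 4 * m * n.n₁₁) * C n) * e (n.phase τ z w x y))
      (∑ j ∈ Finset.range p, ∑ b ∈ Finset.Ico 1 p, triTerm k m p φ p b p τ (z + j) w x y) := by
  have hp0 := hp.out.ne_zero
  have hp' : (p : ℂ) ≠ 0 := by exact_mod_cast hp0
  have key : ∀ j b l u : ℕ, HasSum (fun n : FourierIndex =>
      C n * e (((n.n₁₁ - n.r₁ * l + m * (l : ℤ) ^ 2 : ℤ) : ℂ) * b / p) * e (n.phase τ z w x y))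
      (slashHeis m l u (slashMat k m (triMat p p b p) φ) τ (z + j) w x y) := by
    intro j b l u
    have hj : InH τ (z + j) w := by simpa using hH.add_int 0 j 0
    rw [← (FourierIndex.shiftEquiv m l).hasSum_iff]
    refine (h.hasSum_slash b (sq _).symm l u hj x y).congr_fun fun n => ?_
    simp only [Function.comp, FourierIndex.shiftEquiv, Equiv.coe_fn_mk, h.coeff_shift]
    rw [mul_assoc, ← e_add]
    congr 1
    push_cast
    rw [div_self hp', one_pow, inv_one, one_mul,
      ← e_add_intCast _ (m * u * l + j * n.n₁₂ + n.r₁ * u + n.r₂ * l * j)]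
    congr 1
    simp only [FourierIndex.phase, FourierIndex.shift]
    push_cast
    field_simp
    ring
  have h1 := hasSum_sum fun j (_ : j ∈ Finset.range p) =>
    hasSum_sum fun b (_ : b ∈ Finset.Ico 1 p) =>
      hasSum_sum fun l (_ : l ∈ Finset.range p) =>
        hasSum_sum fun u (_ : u ∈ Finset.range p) => key j b l u
  refine h1.congr_fun fun n => ?_
  simp only [Finset.sum_const, Finset.card_range, nsmul_eq_mul]
  rw [Finset.sum_comm]
  simp only [← Finset.mul_sum, ← Finset.sum_mul, sum_e_div_Ico hp.out.pos]
  have := sum_quadratic_roots hpm n.n₁₁ n.r₁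
  simp only [this]
  ring

/-- The contribution of the representatives `(1, b; 0, p²)`. The sums over `j`, `b` and the second
Heisenberg coordinate vanish unless the index lies in the range of `scale p`. -/
theorem CoordJacobiForm.hasSum_triTerm_one_sq (hm : 0 < m)
    (h : CoordJacobiForm k m φ C) {τ z w : ℂ} (hH : InH τ z w) (x y : ℂ) :
    HasSum (fun n : FourierIndex => (p : ℂ) ^ 5 * ((p : ℂ) ^ k)⁻¹ *
        coeff m C (p * n.r₁) n.r₂ (n.D₁ m * p ^ 2) (n.D₂ m) (n.D m * p) * e (n.phase τ z w x y))
      (∑ j ∈ Finset.range p, ∑ b ∈ Finset.range (p ^ 2),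
        triTerm k m p φ 1 b (p ^ 2) τ (z + j) w x y) := by
  have hp0 := hp.out.ne_zero
  have hp' : (p : ℂ) ≠ 0 := by exact_mod_cast hp0
  have key : ∀ l : ℕ, HasSum (fun n : FourierIndex => (p : ℂ) ^ 4 * ((p : ℂ) ^ k)⁻¹ *
        coeff m C (p * n.r₁) n.r₂ (n.D₁ m * p ^ 2) (n.D₂ m) (n.D m * p) * e (n.phase τ z w x y))
      (∑ j ∈ Finset.range p, ∑ b ∈ Finset.range (p ^ 2), ∑ u ∈ Finset.range p,
        slashHeis m l u (slashMat k m (triMat p 1 b (p ^ 2)) φ) τ (z + j) w x y) := by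
    intro l
    have hterm : ∀ j b u : ℕ, HasSum (fun n : FourierIndex => C n * (((p : ℂ) ^ k)⁻¹ *
        (e ((m * ((l : ℂ) ^ 2 * τ + 2 * l * x)) + n.phase (τ / p ^ 2) (z / p) w
          ((x + l * τ) / p) (y + l * z)) *
        (e (n.n₁₂ * j / p) * e (n.n₁₁ * b / (p ^ 2 : ℕ)) * e (n.r₁ * u / p)))))
        (slashHeis m l u (slashMat k m (triMat p 1 b (p ^ 2)) φ) τ (z + j) w x y) := by
      intro j b u
      have hj : InH τ (z + j) w := by simpa using hH.add_int 0 j 0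
      refine (h.hasSum_slash b (one_mul _) l u hj x y).congr_fun fun n => ?_
      rw [← e_add, ← e_add, ← e_add]
      push_cast
      congr 2
      · field_simp
      · rw [← e_add_intCast _ (m * u * l + n.r₂ * l * j)]
        congr 1
        simp only [FourierIndex.phase]
        push_cast
        field_simp
        ring
    have h1 := hasSum_sum fun j (_ : j ∈ Finset.range p) =>
      hasSum_sum fun b (_ : b ∈ Finset.range (p ^ 2)) =>
        hasSum_sum fun u (_ : u ∈ Finset.range p) => hterm j b u
    simp only [← Finset.mul_sum, ← Finset.sum_mul, sum_e_div _ hp.out.pos,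
      sum_e_div _ (pow_pos hp.out.pos 2)] at h1
    -- Only the indices in the range of `scale p` contribute.
    rw [← (FourierIndex.scale_injective hp0).hasSum_iff] at h1
    swap
    · intro n hn
      rw [FourierIndex.mem_range_scale] at hn
      push_cast
      by_cases h2 : (p : ℤ) ^ 2 ∣ n.n₁₁
      · by_cases h3 : (p : ℤ) ∣ n.n₁₂
        · by_cases h4 : (p : ℤ) ∣ n.r₁
          · exact absurd ⟨h2, h3, h4⟩ hn
          · simp [h4]
        · simp [h3]
      · simp [h2]
    rw [← (FourierIndex.shiftEquiv m l).hasSum_iff]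
    refine h1.congr_fun fun n => ?_
    simp only [Function.comp, FourierIndex.shiftEquiv, Equiv.coe_fn_mk]
    rw [h.coeff_eq hm (n := n.scale p)]
    · have h2 := (FourierIndex.mem_range_scale (n.scale p)).1 ⟨n, rfl⟩
      push_cast
      rw [if_pos h2.1, if_pos h2.2.1, if_pos h2.2.2]
      have : m * ((l : ℂ) ^ 2 * τ + 2 * l * x) + (n.scale p).phase (τ / p ^ 2) (z / p) w
          ((x + l * τ) / p) (y + l * z) = (n.shift m l).phase τ z w x y := by
        simp only [FourierIndex.phase, FourierIndex.shift, FourierIndex.scale]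
        push_cast
        field_simp
        ring
      rw [this]
      ring
    · rw [FourierIndex.r₁_scale, FourierIndex.r₁_shift]
    · rfl
    · rw [FourierIndex.D₁_scale, FourierIndex.D₁_shift]
    · rw [FourierIndex.D₂_scale, FourierIndex.D₂_shift]
    · rw [FourierIndex.D_scale, FourierIndex.D_shift]
  have h1 := hasSum_sum fun l (_ : l ∈ Finset.range p) => key l
  have h2 : ∑ l ∈ Finset.range p, ∑ j ∈ Finset.range p, ∑ b ∈ Finset.range (p ^ 2),
      ∑ u ∈ Finset.range p, slashHeis m l u (slashMat k m (triMat p 1 b (p ^ 2)) φ)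
        τ (z + j) w x y =
      ∑ j ∈ Finset.range p, ∑ b ∈ Finset.range (p ^ 2),
        triTerm k m p φ 1 b (p ^ 2) τ (z + j) w x y := by
    rw [Finset.sum_comm]
    refine Finset.sum_congr rfl fun j _ => ?_
    rw [Finset.sum_comm]
    rfl
  rw [h2] at h1
  refine h1.congr_fun fun n => ?_
  simp only [Finset.sum_const, Finset.card_range, nsmul_eq_mul]
  ring

/-- The Fourier coefficients, up to the factor `p ^ (k - 1)`, of the average of `Φ | T^J(p)^↑` over
the translations `z ↦ z + j`. -/
def heckeCoeff (k m p : ℕ) [Fact p.Prime] (C : FourierIndex → ℂ) (n : FourierIndex) : ℂ :=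
  legendreSym p (n.r₁ ^ 2 - 4 * m * n.n₁₁) * C n +
    (p : ℂ) ^ (2 - (k : ℤ)) *
      coeff m C (p * n.r₁) n.r₂ (n.D₁ m * p ^ 2) (n.D₂ m) (n.D m * p) +
    (p : ℂ) ^ ((k : ℤ) - 1) *
      coeff m C ((p : ZMod (2 * m))⁻¹ * n.r₁) n.r₂ (n.D₁ m / p ^ 2) (n.D₂ m) (n.D m / p)

/-- The Fourier expansion of the average of `Φ | T^J(p)^↑` over the translations `z ↦ z + j`, which
remove the indices with fractional `n₁₂ / p`. -/
theorem CoordJacobiForm.hasSum_heckeSum (hm : 0 < m) (hpm : p.Coprime (2 * m))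
    (h : CoordJacobiForm k m φ C) {τ z w : ℂ} (hH : InH τ z w) (x y : ℂ) :
    HasSum (fun n : FourierIndex =>
        (p : ℂ) ^ ((k : ℤ) - 1) * heckeCoeff k m p C n * e (n.phase τ z w x y))
      (∑ j ∈ Finset.range p, heckeSum k m p φ τ (z + j) w x y) := by
  have hp' : (p : ℂ) ≠ 0 := by exact_mod_cast hp.out.ne_zero
  have h1 := (((h.hasSum_triTerm_sq_one hm hpm hH x y).add
    (h.hasSum_triTerm_diag hpm hH x y)).add (h.hasSum_triTerm_one_sq (p := p) hm hH x y)).mul_left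
      ((p : ℂ) ^ ((k : ℤ) - 4))
  have h2 : ∀ j ∈ Finset.range p, heckeSum k m p φ τ (z + j) w x y = (p : ℂ) ^ ((k : ℤ) - 4) *
      (triTerm k m p φ (p ^ 2) 0 1 τ (z + j) w x y +
        ∑ b ∈ Finset.Ico 1 p, triTerm k m p φ p b p τ (z + j) w x y +
        ∑ b ∈ Finset.range (p ^ 2), triTerm k m p φ 1 b (p ^ 2) τ (z + j) w x y) := by
    intro j _
    have hj : InH τ (z + j) w := by simpa using hH.add_int 0 j 0
    exact h.heckeSum_eq hj x y
  rw [Finset.sum_congr rfl h2, ← Finset.mul_sum, Finset.sum_add_distrib, Finset.sum_add_distrib]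
  refine h1.congr_fun fun n => ?_
  have e1 : (p : ℂ) ^ ((k : ℤ) - 4) = (p : ℂ) ^ k / p ^ 4 := by
    rw [zpow_sub₀ hp']; norm_cast
  have e2 : (p : ℂ) ^ ((k : ℤ) - 1) = (p : ℂ) ^ k / p := by
    rw [zpow_sub₀ hp']; norm_cast; simp
  have e3 : (p : ℂ) ^ (2 - (k : ℤ)) = (p : ℂ) ^ 2 / p ^ k := by
    rw [zpow_sub₀ hp']; norm_cast
  rw [heckeCoeff, e1, e2, e3]
  field_simp
  ring

end

/-! ### The Hecke duality relation -/

/-- If the invariants `(p r₁, r₂, p² D₁, D₂, p D)` occur for integers `D₁`, `D`, then so do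
`(r₁, r₂, D₁, D₂, D)`, because `p` is prime to `4 m`. -/
theorem FourierIndex.exists_of_scale {m p : ℕ} [hp : Fact p.Prime] (hpm : p.Coprime (2 * m))
    {n : FourierIndex} {r₁ : ZMod (2 * m)} {D₁ D : ℤ} (h1 : (n.r₁ : ZMod (2 * m)) = p * r₁)
    (hD1 : n.D₁ m = D₁ * p ^ 2) (hD : n.D m = D * p) :
    ∃ n' : FourierIndex, (n'.r₁ : ZMod (2 * m)) = r₁ ∧ n'.r₂ = n.r₂ ∧ n'.D₁ m = D₁ ∧
      n'.D₂ m = n.D₂ m ∧ n'.D m = D := by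
  have hp0 := hp.out.ne_zero
  have hpq : (p : ℚ) ≠ 0 := by exact_mod_cast hp0
  have hpz : (p : ℤ) ≠ 0 := by exact_mod_cast hp0
  obtain ⟨s, rfl⟩ := ZMod.intCast_surjective r₁
  obtain ⟨l, hl⟩ := FourierIndex.exists_shift (n := n) (r := p * s) (by rw [h1]; push_cast; rfl)
  have hD1' := (n.D₁_shift m l).trans hD1
  have hD' := (n.D_shift m l).trans hD
  have hr2 : (n.shift m l).r₂ = n.r₂ := rfl
  have hD2 := n.D₂_shift m l
  have hcop : IsCoprime (p : ℤ) ((2 * m : ℕ) : ℤ) := Nat.isCoprime_iff_coprime.2 hpm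
  have hcop2 : IsCoprime (p : ℤ) 2 := by
    push_cast at hcop
    exact hcop.of_mul_right_left
  rw [FourierIndex.D₁_eq, hl] at hD1'
  rw [FourierIndex.D_eq, hl] at hD'
  have h11 : (p : ℤ) ^ 2 ∣ (n.shift m l).n₁₁ := by
    have : (p : ℤ) ^ 2 ∣ (2 * (2 * m : ℕ) : ℤ) * (n.shift m l).n₁₁ := by
      refine ⟨s ^ 2 - D₁, ?_⟩
      have h2 : (p * s : ℤ) ^ 2 - 4 * m * (n.shift m l).n₁₁ = D₁ * p ^ 2 := by
        exact_mod_cast hD1'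
      push_cast
      linear_combination -h2
    exact (hcop2.mul_right hcop).pow_left.dvd_of_dvd_mul_left this
  have h12 : (p : ℤ) ∣ (n.shift m l).n₁₂ := by
    have : (p : ℤ) ∣ ((2 * m : ℕ) : ℤ) * (n.shift m l).n₁₂ := by
      refine ⟨s * (n.shift m l).r₂ - D, ?_⟩
      have h2 : (p * s : ℤ) * (n.shift m l).r₂ - 2 * m * (n.shift m l).n₁₂ = D * p := by
        exact_mod_cast hD'
      push_cast
      linear_combination -h2
    exact hcop.dvd_of_dvd_mul_left this
  obtain ⟨n', hn'⟩ := (FourierIndex.mem_range_scale (p := p) (n.shift m l)).2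
    ⟨h11, h12, ⟨s, hl⟩⟩
  have hs : n'.r₁ = s := by
    have : (p : ℤ) * n'.r₁ = p * s := by rw [← hl, ← hn']; rfl
    exact mul_left_cancel₀ hpz this
  refine ⟨n', by rw [hs], ?_, ?_, ?_, ?_⟩
  · rw [← hr2, ← hn']; rfl
  · have := (n.D₁_shift m l).trans hD1
    rw [← hn', FourierIndex.D₁_scale] at this
    exact mul_right_cancel₀ (pow_ne_zero 2 hpq) this
  · rw [← hD2, ← hn', FourierIndex.D₂_scale]
  · have := (n.D_shift m l).trans hD
    rw [← hn', FourierIndex.D_scale] at this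
    exact mul_right_cancel₀ hpq this

section

variable {p : ℕ} [hp : Fact p.Prime] {k m : ℕ} {φ : CoordFun} {C : FourierIndex → ℂ}

/-- If the invariants `(r₁, r₂, D₁, D₂, D)` do not occur, then neither do those that arise from
them by multiplication or division by `p` in the first variable. -/
theorem coeff_scale_eq_zero (hpm : p.Coprime (2 * m)) {r₁ r₂ : ZMod (2 * m)} {D₁ D₂ D : ℤ}
    (hex : ¬ ∃ n : FourierIndex, (n.r₁ : ZMod (2 * m)) = r₁ ∧ (n.r₂ : ZMod (2 * m)) = r₂ ∧
      n.D₁ m = D₁ ∧ n.D₂ m = D₂ ∧ n.D m = D) (C : FourierIndex → ℂ) :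
    coeff m C (p * r₁) r₂ (D₁ * p ^ 2) D₂ (D * p) = 0 ∧
      coeff m C ((p : ZMod (2 * m))⁻¹ * r₁) r₂ (D₁ / p ^ 2) D₂ (D / p) = 0 := by
  have hpq : (p : ℚ) ≠ 0 := by exact_mod_cast hp.out.ne_zero
  constructor
  · refine coeff_eq_zero fun n h1 h2 h3 h4 h5 => hex ?_
    obtain ⟨n', a1, a2, a3, a4, a5⟩ := FourierIndex.exists_of_scale hpm h1 h3 h5
    exact ⟨n', a1, by rw [a2, h2], a3, a4.trans h4, a5⟩
  · refine coeff_eq_zero fun n h1 h2 h3 h4 h5 => hex ⟨n.scale p, ?_, h2, ?_, ?_, ?_⟩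
    · rw [FourierIndex.r₁_scale, h1, mul_natCast_inv hpm]
    · rw [FourierIndex.D₁_scale, h3]; field_simp
    · rw [FourierIndex.D₂_scale, h4]
    · rw [FourierIndex.D_scale, h5]; field_simp

theorem CoordJacobiForm.heckeCoeff_flip (hm : 0 < m) (h : CoordJacobiForm k m φ C)
    (n : FourierIndex) : heckeCoeff k m p (C ∘ FourierIndex.flip) n.flip =
      legendreSym p (n.r₂ ^ 2 - 4 * m * n.n₂₂) * C n +
        (p : ℂ) ^ (2 - (k : ℤ)) *
          coeff m C n.r₁ (p * n.r₂) (n.D₁ m) (n.D₂ m * p ^ 2) (n.D m * p) +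
        (p : ℂ) ^ ((k : ℤ) - 1) *
          coeff m C n.r₁ ((p : ZMod (2 * m))⁻¹ * n.r₂) (n.D₁ m) (n.D₂ m / p ^ 2) (n.D m / p) := by
  simp only [heckeCoeff, FourierIndex.D₁_flip, FourierIndex.D₂_flip, FourierIndex.D_flip]
  rw [← h.coeff_flip hm, ← h.coeff_flip hm]
  rfl

/-- The Hecke duality relation says that the averages of `Φ | T^J(p)^↑` and of `Φ | T^J(p)^↓` have
the same Fourier coefficients. -/
theorem CoordJacobiForm.heckeDualityRelation_iff (hm : 0 < m) (hpm : p.Coprime (2 * m))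
    (h : CoordJacobiForm k m φ C) : HeckeDualityRelation k m p C ↔
      ∀ n, heckeCoeff k m p C n = heckeCoeff k m p (C ∘ FourierIndex.flip) n.flip := by
  have hcast1 : ∀ n : FourierIndex,
      n.D₁ m = ((n.r₁ ^ 2 - 4 * m * n.n₁₁ : ℤ) : ℚ) := fun n => by
    rw [FourierIndex.D₁_eq]; push_cast; rfl
  have hcast2 : ∀ n : FourierIndex,
      n.D₂ m = ((n.r₂ ^ 2 - 4 * m * n.n₂₂ : ℤ) : ℚ) := fun n => by
    rw [FourierIndex.D₂_eq]; push_cast; rfl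
  have hcast : ∀ n : FourierIndex,
      n.D m = ((n.r₁ * n.r₂ - 2 * m * n.n₁₂ : ℤ) : ℚ) := fun n => by
    rw [FourierIndex.D_eq]; push_cast; rfl
  have key : ∀ n : FourierIndex,
      (((legendreSym p (n.r₁ ^ 2 - 4 * m * n.n₁₁) : ℂ) -
          (legendreSym p (n.r₂ ^ 2 - 4 * m * n.n₂₂) : ℂ)) *
          coeff m C n.r₁ n.r₂ (n.D₁ m) (n.D₂ m) (n.D m) =
        (p : ℂ) ^ (2 - (k : ℤ)) *
          (coeff m C n.r₁ (p * n.r₂) (n.D₁ m) (n.D₂ m * p ^ 2) (n.D m * p) -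
            coeff m C (p * n.r₁) n.r₂ (n.D₁ m * p ^ 2) (n.D₂ m) (n.D m * p)) +
        (p : ℂ) ^ ((k : ℤ) - 1) *
          (coeff m C n.r₁ ((p : ZMod (2 * m))⁻¹ * n.r₂) (n.D₁ m) (n.D₂ m / p ^ 2) (n.D m / p) -
            coeff m C ((p : ZMod (2 * m))⁻¹ * n.r₁) n.r₂ (n.D₁ m / p ^ 2) (n.D₂ m)
              (n.D m / p))) ↔
      heckeCoeff k m p C n = heckeCoeff k m p (C ∘ FourierIndex.flip) n.flip := by
    intro n
    rw [h.heckeCoeff_flip hm, heckeCoeff, h.coeff_eq hm rfl rfl rfl rfl rfl]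
    constructor <;> intro h1 <;> linear_combination h1
  constructor
  · intro hrel n
    rw [← key]
    have := hrel (n.r₁ ^ 2 - 4 * m * n.n₁₁) (n.r₂ ^ 2 - 4 * m * n.n₂₂)
      (n.r₁ * n.r₂ - 2 * m * n.n₁₂) n.r₁ n.r₂
    rwa [← hcast1, ← hcast2, ← hcast] at this
  · intro hn D₁ D₂ D r₁ r₂
    by_cases hex : ∃ n : FourierIndex, (n.r₁ : ZMod (2 * m)) = r₁ ∧ (n.r₂ : ZMod (2 * m)) = r₂ ∧
      n.D₁ m = D₁ ∧ n.D₂ m = D₂ ∧ n.D m = D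
    · obtain ⟨n, rfl, rfl, h3, h4, h5⟩ := hex
      have e1 : n.r₁ ^ 2 - 4 * m * n.n₁₁ = D₁ := by exact_mod_cast (hcast1 n).symm.trans h3
      have e2 : n.r₂ ^ 2 - 4 * m * n.n₂₂ = D₂ := by exact_mod_cast (hcast2 n).symm.trans h4
      have := (key n).2 (hn n)
      rwa [e1, e2, h3, h4, h5] at this
    · have hex' : ¬ ∃ n : FourierIndex, (n.r₁ : ZMod (2 * m)) = r₂ ∧
          (n.r₂ : ZMod (2 * m)) = r₁ ∧ n.D₁ m = D₂ ∧ n.D₂ m = D₁ ∧ n.D m = D := by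
        rintro ⟨n, h1, h2, h3, h4, h5⟩
        exact hex ⟨n.flip, h2, h1, (n.D₁_flip m).trans h4, (n.D₂_flip m).trans h3,
          (n.D_flip m).trans h5⟩
      have z0 := coeff_eq_zero (C := C) fun n h1 h2 h3 h4 h5 => hex ⟨n, h1, h2, h3, h4, h5⟩
      obtain ⟨z1, z2⟩ := coeff_scale_eq_zero hpm hex C
      obtain ⟨z3, z4⟩ := coeff_scale_eq_zero hpm hex' (C ∘ FourierIndex.flip)
      rw [h.coeff_flip hm] at z3 z4
      rw [z0, z1, z2, z3, z4]
      simp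

/-! ### The difference of the two Hecke operators -/

/-- `Φ | (T^J(p)^↑ - T^J(p)^↓)` in coordinates. -/
def heckeDiff (k m p : ℕ) [NeZero p] (φ : CoordFun) : CoordFun := fun τ z w x y =>
  heckeSum k m p φ τ z w x y - flip (heckeSum k m p (flip φ)) τ z w x y

theorem CoordJacobiForm.hasSum_heckeDiff (hm : 0 < m) (hpm : p.Coprime (2 * m))
    (h : CoordJacobiForm k m φ C) {τ z w : ℂ} (hH : InH τ z w) (x y : ℂ) :
    HasSum (fun n : FourierIndex => (p : ℂ) ^ ((k : ℤ) - 1) *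
        (heckeCoeff k m p C n - heckeCoeff k m p (C ∘ FourierIndex.flip) n.flip) *
          e (n.phase τ z w x y))
      (∑ j ∈ Finset.range p, heckeDiff k m p φ τ (z + j) w x y) := by
  have h1 := h.hasSum_heckeSum (p := p) hm hpm hH x y
  have h2 := h.flip.hasSum_heckeSum (p := p) hm hpm hH.symm y x
  rw [← FourierIndex.flipEquiv.hasSum_iff] at h2
  have h3 := h1.sub h2
  rw [← Finset.sum_sub_distrib] at h3
  refine h3.congr_fun fun n => ?_
  simp only [Function.comp, FourierIndex.flipEquiv, Equiv.coe_fn_mk, FourierIndex.phase_flip]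
  ring

/-- The difference of the two operators has the invariance properties required by the vanishing
criterion `eq_zero_of_sum_translates`. -/
theorem CoordJacobiForm.heckeDiff_eq_zero (h : CoordJacobiForm k m φ C)
    (hsum : ∀ τ z w x y, InH τ z w →
      ∑ j ∈ Finset.range p, heckeDiff k m p φ τ (z + j) w x y = 0)
    {τ z w : ℂ} (hH : InH τ z w) (x y : ℂ) : heckeDiff k m p φ τ z w x y = 0 := by
  refine eq_zero_of_sum_translates (p := p) (k := k) (m := m) ?_ ?_ ?_ ?_ hsum hH x y
  · intro τ z w x y hH
    have h1 := h.slashMat_S_heckeSum (ℓ := p) hH x y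
    have h2 := h.slashMat_S_flip_heckeSum (p := p) hH x y
    rw [heckeDiff, ← h1, ← h2]
    simp only [slashMat, heckeDiff, mul_sub]
  · intro τ z w x y hH
    have h2 := h.flip.heckeSum_add_one_right (p := p) hH.symm y x
    simp only [heckeDiff, HeckeJacobi.flip] at h2 ⊢
    rw [h.heckeSum_add_one hH, h2]
  · intro τ z w x y hH
    have h2 := h.flip.heckeSum_add_one (ℓ := p) hH.symm y x
    simp only [heckeDiff, HeckeJacobi.flip] at h2 ⊢
    rw [h.heckeSum_add_one_right hH, h2]
  · intro τ z w x y hH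
    have h2 := h.flip.heckeSum_add_p (p := p) hH.symm y x
    simp only [heckeDiff, HeckeJacobi.flip] at h2 ⊢
    rw [h.heckeSum_add_p hH, h2]

/-- The two Hecke operators agree if and only if the Fourier coefficients satisfy the Hecke duality
relation: the relation is equivalent to the vanishing of the averages of their difference. -/
theorem CoordJacobiForm.heckeDiff_eq_zero_iff (hm : 0 < m) (hpm : p.Coprime (2 * m))
    (h : CoordJacobiForm k m φ C) :
    (∀ τ z w x y, InH τ z w → heckeDiff k m p φ τ z w x y = 0) ↔
      HeckeDualityRelation k m p C := by
  have hp' : (p : ℂ) ≠ 0 := by exact_mod_cast hp.out.ne_zero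
  rw [h.heckeDualityRelation_iff hm hpm]
  constructor
  · intro h0 n
    have h1 := fourier_eq_zero (c := fun n => (p : ℂ) ^ ((k : ℤ) - 1) *
      (heckeCoeff k m p C n - heckeCoeff k m p (C ∘ FourierIndex.flip) n.flip)) ?_ n
    · exact sub_eq_zero.1 ((mul_eq_zero.1 h1).resolve_left (zpow_ne_zero _ hp'))
    · intro τ z w x y hH
      have h2 := h.hasSum_heckeDiff hm hpm hH x y
      rwa [Finset.sum_eq_zero fun (j : ℕ) _ => h0 τ (z + j) w x y
        (by simpa using hH.add_int 0 j 0)] at h2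
  · intro hn τ z w x y hH
    refine h.heckeDiff_eq_zero (fun τ z w x y hH => ?_) hH x y
    refine (h.hasSum_heckeDiff hm hpm hH x y).unique ?_
    simp [hn]

end

end HeckeJacobi

end

theorem mainTheorem1 (k m p : ℕ) (hk : 0 < k) (hm : 0 < m) [Fact p.Prime]
    (hp : Nat.Coprime p (2 * m)) (Φ : Matrix (Fin 2) (Fin 2) ℂ → (Fin 2 → ℂ) → ℂ)
    (hΦ : HeckeJacobi.IsJacobiForm k m Φ) :
    HeckeJacobi.MemHeckeDuality k m p Φ ↔
      ∀ T ∈ HeckeJacobi.siegelUpperHalfSpace 2, ∀ Z : Fin 2 → ℂ,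
        HeckeJacobi.heckeUp k m p Φ T Z - HeckeJacobi.heckeDown k m p Φ T Z = 0 := by
  open HeckeJacobi in
  have key : (∀ T ∈ siegelUpperHalfSpace 2, ∀ Z : Fin 2 → ℂ,
      heckeUp k m p Φ T Z - heckeDown k m p Φ T Z = 0) ↔
      ∀ τ z w x y, InH τ z w → heckeDiff k m p (toCoord Φ) τ z w x y = 0 := by
    constructor
    · intro h τ z w x y hH
      have := h _ ((mem_siegelUpperHalfSpace_iff τ z w).2 hH) ![x, y]
      rwa [heckeUp_eq k m p Φ hH, heckeDown_eq k m p Φ hH] at this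
    · intro h T hT Z
      obtain ⟨τ, z, w, hH, rfl⟩ := exists_of_mem_siegelUpperHalfSpace hT
      have hZ : Z = ![Z 0, Z 1] := by ext i; fin_cases i <;> rfl
      rw [hZ, heckeUp_eq k m p Φ hH, heckeDown_eq k m p Φ hH]
      exact h τ z w (Z 0) (Z 1) hH
  rw [key]
  constructor
  · rintro ⟨-, C, hC, hrel⟩
    exact ((hΦ.coord hC).heckeDiff_eq_zero_iff hm hp).2 hrel
  · intro h
    obtain ⟨C, hC⟩ := hΦ.fourier
    exact ⟨hΦ, C, hC, ((hΦ.coord hC).heckeDiff_eq_zero_iff hm hp).1 h⟩
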